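/- Let $d\in\{2,3\}$, and let $p>4$ be a real number if $d=2$, and $p=6$ if $d=3$. Let $\Omega\subset\mathbb R^d$ be a bounded Lipschitz domain (connectedness is not needed), with boundary $\Gamma=\partial\Omega$. For $g$ on $\Gamma$ put $H^1_g(\Omega)=\{v\in H^1(\Omega): v|_\Gamma=g\}$ in the sense of traces, and let $H^1_0(\Omega)$ be this space for $g=0$. Then the Poincaré–Sobolev inequality $$\|v\|_{L^p(\Omega)}\le C_s(p)\,\|\nabla v\|_{L^2(\Omega)}\qquad\text{for all } v\in H^1_0(\Omega)$$ holds with some finite constant $C_s(p)\ge 0$, and for every such constant $C_s(p)$ the following is true. Assume that: - (A1) $D:\Omega\to\mathbb R^{d\times d}$ belongs to $L^\infty(\Omega)$ and there are constants $m,M>0$ such that, for a.e. $x\in\Omega$, $m|\xi|^2\le \xi^T D(x)\xi\le M|\xi|^2$ for all $\xi\in\mathbb R^d$; - (A2) $f\in L^2(\Omega)$ and $g\in L^\infty(\Gamma)$; - (A3) $b:\Omega\times\mathbb R\to\mathbb R$ is such that $b(\cdot,\xi)$ is measurable on $\Omega$ for every $\xi\in\mathbb R$ and, for every $x\in\Omega$,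 $b(x,\cdot)$ is $C^\infty$ with $\partial_\xi b(x,\xi)\ge 0$ for all $\xi\in\mathbb R$ and $b(x,0)=0$. Let $u\in H^1_g(\Omega)$ be a weak solution of $-\nabla\cdot(D\nabla u)+b(x,u)=f$ in $\Omega$, $u|_\Gamma=g$; that is, for all $v\in H^1_0(\Omega)$ the function $b(\cdot,u)\,v$ is integrable on $\Omega$ and $$\int_\Omega D\nabla u\cdot\nabla v\,dx+\int_\Omega b(x,u)\,v\,dx=\int_\Omega f v\,dx .$$ Then, for a.e. $x\in\Omega$, $$\min\{0,\operatorname*{ess\,inf}_{\Gamma} g\}-C\|f\|_{L^2(\Omega)}\;\le\; u(x)\;\le\;\max\{0,\operatorname*{ess\,sup}_{\Gamma} g\}+C\|f\|_{L^2(\Omega)},$$ where $$C=\frac{C_s(p)^2}{m}\,|\Omega|^{\frac{p-4}{2p}}\,2^{\frac{p-2}{p-4}} .$$ -/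

import Mathlib

open MeasureTheory Filter Topology
open scoped ContDiff ENNReal NNReal

noncomputable section

namespace SemilinearPDE

/-- Euclidean space of dimension `d`. -/
abbrev E (d : ℕ) : Type := EuclideanSpace ℝ (Fin d)

/-- A bounded Lipschitz domain: a bounded open set which, near each of its boundary points, is the
set of points lying strictly above the graph of a Lipschitz function `γ`, where "above" refers to
some unit direction `e` and `γ` is defined on the hyperplane orthogonal to `e`. Connectedness is
not required. -/
structure IsBoundedLipschitzDomain {d : ℕ} (Ω : Set (E d)) : Prop where
  isOpen : IsOpen Ω
  isBounded : Bornology.IsBounded Ω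
  lipschitz_boundary : ∀ x₀ ∈ frontier Ω, ∃ e : E d, ‖e‖ = 1 ∧
    ∃ (L : ℝ≥0) (γ : (ℝ ∙ e)ᗮ → ℝ), LipschitzWith L γ ∧
      ∃ U ∈ 𝓝 x₀, ∀ x ∈ U,
        (x ∈ Ω ↔ γ ((ℝ ∙ e)ᗮ.orthogonalProjectionOnto x) < inner ℝ e x)

/-- Lebesgue measure on `Ω`. -/
abbrev vol {d : ℕ} (Ω : Set (E d)) : Measure (E d) := volume.restrict Ω

/-- Surface measure, that is, `(d - 1)`-dimensional Hausdorff measure, on the boundary of `Ω`. -/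
abbrev surf {d : ℕ} (Ω : Set (E d)) : Measure (E d) :=
  (Measure.euclideanHausdorffMeasure (d - 1)).restrict (frontier Ω)

/-- `u` belongs to `H¹(Ω)` and its weak gradient is `G`. Only the values on `Ω` matter. -/
structure HasH1Gradient {d : ℕ} (Ω : Set (E d)) (u : E d → ℝ) (G : E d → E d) : Prop where
  memLp : MemLp u 2 (vol Ω)
  memLp_grad : MemLp G 2 (vol Ω)
  weak_deriv : ∀ φ : E d → ℝ, ContDiff ℝ ∞ φ → HasCompactSupport φ → tsupport φ ⊆ Ω →
    ∀ i : Fin d, ∫ x in Ω, u x * fderiv ℝ φ x (EuclideanSpace.single i 1)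
      = -∫ x in Ω, G x i * φ x

/-- `u`, with weak gradient `G`, belongs to `H¹(Ω)` and its trace on the boundary is `g`. The trace
operator is the continuous extension to `H¹(Ω)` of the restriction to the boundary of functions
that are smooth up to the boundary: there are smooth functions converging to `u` in `H¹(Ω)` whose
boundary values converge to `g` in `L²` of the boundary. This expresses `u ∈ H¹_g(Ω)`; for `g = 0`
it expresses `u ∈ H¹₀(Ω)`. -/
structure MemH1g {d : ℕ} (Ω : Set (E d)) (g : E d → ℝ) (u : E d → ℝ) (G : E d → E d) :
    Prop where
  hasH1Gradient : HasH1Gradient Ω u G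
  trace : ∃ φ : ℕ → E d → ℝ, (∀ n, ContDiff ℝ ∞ (φ n)) ∧
    Tendsto (fun n => eLpNorm (fun x => φ n x - u x) 2 (vol Ω)) atTop (𝓝 0) ∧
    Tendsto (fun n => eLpNorm (fun x => gradient (φ n) x - G x) 2 (vol Ω)) atTop (𝓝 0) ∧
    Tendsto (fun n => eLpNorm (fun x => φ n x - g x) 2 (surf Ω)) atTop (𝓝 0)

/-- `K` is an admissible constant in the Poincaré-Sobolev inequality
`‖v‖_{L^p(Ω)} ≤ K ‖∇v‖_{L²(Ω)}` for all `v ∈ H¹₀(Ω)`. -/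
def IsPoincareSobolevConst {d : ℕ} (Ω : Set (E d)) (p K : ℝ) : Prop :=
  0 ≤ K ∧ ∀ (v : E d → ℝ) (Gv : E d → E d), MemH1g Ω 0 v Gv →
    eLpNorm v (ENNReal.ofReal p) (vol Ω) ≤ ENNReal.ofReal K * eLpNorm Gv 2 (vol Ω)

/-- Assumption on the diffusion tensor: `D ∈ L^∞(Ω)` and `m |ξ|² ≤ ξᵀ D(x) ξ ≤ M |ξ|²`. -/
structure IsDiffusionTensor {d : ℕ} (Ω : Set (E d)) (D : E d → Matrix (Fin d) (Fin d) ℝ)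
    (m M : ℝ) : Prop where
  m_pos : 0 < m
  M_pos : 0 < M
  memLp : ∀ i j, MemLp (fun x => D x i j) ∞ (vol Ω)
  elliptic : ∀ᵐ x ∂(vol Ω), ∀ ξ : E d,
    m * ‖ξ‖ ^ 2 ≤ ∑ i, ∑ j, ξ i * D x i j * ξ j ∧
    ∑ i, ∑ j, ξ i * D x i j * ξ j ≤ M * ‖ξ‖ ^ 2

/-- `b : Ω × ℝ → ℝ` is measurable in the first and smooth in the second variable, nondecreasing in
the second variable, and vanishes when the second variable is zero. -/
structure IsMonotoneCaratheodory {d : ℕ} (Ω : Set (E d)) (b : E d → ℝ → ℝ) : Prop where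
  measurable : ∀ ξ, AEMeasurable (fun x => b x ξ) (vol Ω)
  smooth : ∀ x ∈ Ω, ContDiff ℝ ∞ (b x)
  monotone : ∀ x ∈ Ω, ∀ ξ, 0 ≤ deriv (b x) ξ
  zero : ∀ x ∈ Ω, b x 0 = 0

/-- `u ∈ H¹_g(Ω)` is a weak solution of `-∇·(D∇u) + b(x,u) = f` in `Ω`, `u = g` on the boundary:
`∫ D∇u·∇v + ∫ b(x,u) v = ∫ f v` for all `v ∈ H¹₀(Ω)`. That `b(x,u) v` is integrable is part of the
meaning of the equation. -/
def IsWeakSolution {d : ℕ} (Ω : Set (E d)) (D : E d → Matrix (Fin d) (Fin d) ℝ)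
    (b : E d → ℝ → ℝ) (f g u : E d → ℝ) : Prop :=
  ∃ Gu : E d → E d, MemH1g Ω g u Gu ∧
    ∀ (v : E d → ℝ) (Gv : E d → E d), MemH1g Ω 0 v Gv →
      IntegrableOn (fun x => b x (u x) * v x) Ω ∧
      (∫ x in Ω, ∑ i, ∑ j, D x i j * Gu x j * Gv x i) + ∫ x in Ω, b x (u x) * v x
        = ∫ x in Ω, f x * v x

/-- The constant `C = (K² / m) |Ω|^{(p-4)/(2p)} 2^{(p-2)/(p-4)}`. -/
def boundConst {d : ℕ} (Ω : Set (E d)) (m p K : ℝ) : ℝ :=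
  K ^ 2 / m * (volume Ω).toReal ^ ((p - 4) / (2 * p)) * (2 : ℝ) ^ ((p - 2) / (p - 4))

end SemilinearPDE

end

/-!
The proof has two independent parts: the Poincaré–Sobolev inequality for functions whose trace
vanishes in the sense of approximation by smooth functions, and Stampacchia's iteration over the
superlevel sets of the solution.

**Poincaré–Sobolev.** The point is that the extension by zero of `v ∈ H¹₀(Ω)` has a weak gradient on
the whole space. Approximate `v` by smooth `φ k` with boundary values tending to zero in `L²`. For a
test function `ψ`, the defect in the integration by parts is `∫_Ω ∂ᵢ(φ k ψ)`, so it is enough to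
know that `|∫_Ω ∂ᵢ h| ≤ 2 ∫_{∂Ω} |h|` for smooth, compactly
supported `h` (`enorm_integral_partialDeriv_le`). This crude
form of the divergence theorem needs neither a normal vector nor a partition of unity, and holds
for every bounded open set whose boundary has finite surface measure: write `∂ᵢ h` as a limit of
difference quotients, move the translation onto the indicator function of `Ω`, and observe that it
changes this function only on the sweep of the boundary over a distance `δ`. Cut the boundary into
slabs of height `δ`; since orthogonal projections do not increase Hausdorff measure, the sweep
contributes at most `2 δ ∫_{∂Ω} |h|` up to lower order (`lintegral_sweep_le`). The Lipschitz
assumption enters only through the finiteness of the surface measure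
(`IsBoundedLipschitzDomain.surf_univ_lt_top`). Mollifying the zero extension, applying the
Gagliardo–Nirenberg–Sobolev inequality for smooth functions and passing to the limit by Fatou's
lemma gives `exists_isPoincareSobolevConst`.

**Maximum bound.** For `k ≥ max 0 (ess sup g)`, test the equation with a smooth approximation
`T ∘ u` of `(u - k)⁺`, where `T = ramp k ε`. It lies in `H¹₀(Ω)` by `MemH1g.comp_of_abs_le`, since
on the boundary `|T (φ j)| ≤ |φ j - g|` for the smooth functions `φ j` approximating `u`. Because
`0 ≤ T' ≤ 1`, one has `D ∇u · T'(u) ∇u ≥ m |T'(u) ∇u|²`, so that the sharp constant is kept and only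
the limit `ε → 0` of a single inequality is needed (`IsWeakSolution.level_decay`):
`(h - k) |{u > h}|^(1/p) ≤ (K² / m) ‖f‖ |{u > k}|^((p-2)/(2p))` for `h > k`. As `p > 4`, the exponent
on the right exceeds `1 / p`, and Stampacchia's lemma (`eq_zero_of_stampacchia`) shows that
`{u > h}` is a null set beyond the asserted level. The lower bound follows by applying the upper
bound to `-u`, which solves the equation with nonlinearity `-b(x, -ξ)` and data `-f`, `-g`.
-/

namespace SemilinearPDE

/-! ### Slicing the boundary along a coordinate axis -/

/-- The point of `ℝⁿ` obtained from `x ∈ ℝⁿ⁺¹` by deleting the coordinate `i`. -/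
def dropCoord {n : ℕ} (i : Fin (n + 1)) (x : E (n + 1)) : Fin n → ℝ :=
  fun j => x (i.succAbove j)

/-- The point of `ℝⁿ⁺¹` whose coordinate `i` is `t` and whose other coordinates are those
of `y`. -/
def insertCoord {n : ℕ} (i : Fin (n + 1)) (t : ℝ) (y : Fin n → ℝ) : E (n + 1) :=
  WithLp.toLp 2 (i.insertNth t y)

lemma continuous_dropCoord {n : ℕ} (i : Fin (n + 1)) : Continuous (dropCoord i) := by
  unfold dropCoord
  fun_prop

lemma insertCoord_dropCoord {n : ℕ} (i : Fin (n + 1)) (t : ℝ) (x : E (n + 1)) :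
    insertCoord i t (dropCoord i x) = x + (t - x i) • EuclideanSpace.single i (1 : ℝ) := by
  ext j
  refine Fin.succAboveCases i ?_ (fun k => ?_) j
  · simp [insertCoord]
  · simp [insertCoord, dropCoord, Fin.succAbove_ne]

lemma measurePreserving_insertCoord {n : ℕ} (i : Fin (n + 1)) :
    MeasurePreserving (fun q : ℝ × (Fin n → ℝ) => insertCoord i q.1 q.2)
      (volume.prod volume) volume := by
  have h1 := (volume_preserving_piFinSuccAbove (fun _ : Fin (n + 1) => ℝ) i).symm
  have h2 := PiLp.volume_preserving_toLp (Fin (n + 1))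
  exact h2.comp h1

/-- Deleting a coordinate does not increase Hausdorff measure. -/
lemma volume_image_dropCoord_le {n : ℕ} (i : Fin (n + 1)) (S : Set (E (n + 1))) :
    volume (dropCoord i '' S) ≤ Measure.euclideanHausdorffMeasure n S := by
  have hL : LipschitzWith 1 fun x : E (n + 1) => (WithLp.toLp 2 (dropCoord i x) : E n) := by
    refine LipschitzWith.of_dist_le_mul fun x y => ?_
    rw [NNReal.coe_one, one_mul, EuclideanSpace.dist_eq, EuclideanSpace.dist_eq]
    refine Real.sqrt_le_sqrt ?_
    rw [Fin.sum_univ_succAbove _ i]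
    exact le_add_of_nonneg_left (sq_nonneg _)
  have h1 : volume (dropCoord i '' S)
      = volume ((fun x : E (n + 1) => (WithLp.toLp 2 (dropCoord i x) : E n)) '' S) := by
    rw [← (EuclideanSpace.volume_preserving_symm_measurableEquiv_toLp
      (Fin n)).measure_preimage_equiv (dropCoord i '' S)]
    congr 1
    ext y
    constructor
    · rintro ⟨x, hx, h⟩
      exact ⟨x, hx, by simp only [h]; rfl⟩
    · rintro ⟨x, hx, rfl⟩
      exact ⟨x, hx, rfl⟩
  rw [h1, ← EuclideanSpace.euclideanHausdorffMeasure_eq_volume]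
  simp only [Measure.euclideanHausdorffMeasure_def, Measure.smul_apply]
  gcongr
  simpa using hL.hausdorffMeasure_image_le (d := n) (by positivity) S

/-- Integral form of `volume_image_dropCoord_le`. -/
lemma lintegral_image_dropCoord_le {n : ℕ} (i : Fin (n + 1)) (S : Set (E (n + 1)))
    {F : (Fin n → ℝ) → ℝ≥0∞} (hF : Measurable F) :
    ∫⁻ y in dropCoord i '' S, F y
      ≤ ∫⁻ x in S, F (dropCoord i x) ∂(Measure.euclideanHausdorffMeasure n) := by
  have hm := (continuous_dropCoord i).measurable
  rw [← lintegral_map hF hm]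
  refine lintegral_mono' (Measure.le_iff.2 fun B hB => ?_) le_rfl
  rw [Measure.restrict_apply hB, Measure.map_apply hm hB, Measure.restrict_apply (hm hB)]
  refine le_trans (measure_mono ?_) (volume_image_dropCoord_le i _)
  rintro _ ⟨hy, x, hx, rfl⟩
  exact ⟨x, ⟨hy, hx⟩, rfl⟩

/-- Integration over the slab `a ≤ x i < b` above the projection of a set `S` is controlled by
integration over `S` with respect to Hausdorff measure. -/
lemma lintegral_slab_le {n : ℕ} (i : Fin (n + 1)) (S : Set (E (n + 1))) (a b : ℝ)
    {F : E (n + 1) → ℝ≥0∞} (hF : Measurable F) :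
    ∫⁻ x in {x : E (n + 1) | x i ∈ Set.Ico a b ∧ dropCoord i x ∈ dropCoord i '' S}, F x
      ≤ ∫⁻ t in Set.Ico a b, ∫⁻ x in S, F (x + (t - x i) • EuclideanSpace.single i (1 : ℝ))
          ∂(Measure.euclideanHausdorffMeasure n) := by
  have hmp := measurePreserving_insertCoord i
  set T := {x : E (n + 1) | x i ∈ Set.Ico a b ∧ dropCoord i x ∈ dropCoord i '' S}
  have hpre : (fun q : ℝ × (Fin n → ℝ) => insertCoord i q.1 q.2) ⁻¹' T
      = Set.Ico a b ×ˢ (dropCoord i '' S) := by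
    ext ⟨t, y⟩
    have : dropCoord i (insertCoord i t y) = y := by
      ext j; simp [dropCoord, insertCoord]
    simp only [T, Set.mem_preimage, Set.mem_ofPred_eq, this, Set.mem_prod]
    simp [insertCoord]
  have hemb : MeasurableEmbedding fun q : ℝ × (Fin n → ℝ) => insertCoord i q.1 q.2 :=
    (MeasurableEquiv.toLp 2 (Fin (n + 1) → ℝ)).measurableEmbedding.comp
      (MeasurableEquiv.piFinSuccAbove (fun _ : Fin (n + 1) => ℝ) i).symm.measurableEmbedding
  rw [← hmp.setLIntegral_comp_preimage_emb hemb, hpre, ← Measure.prod_restrict,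
    lintegral_prod _ (by exact (hF.comp hmp.measurable).aemeasurable)]
  refine lintegral_mono fun t => ?_
  refine (lintegral_image_dropCoord_le i S ?_).trans_eq ?_
  · exact hF.comp (hmp.measurable.comp measurable_prodMk_left)
  · simp only [insertCoord_dropCoord]

/-! ### Estimate of the boundary term in integration by parts -/

/-- Estimate of the integral of `|h|` over the `δ`-sweep of `A` in the direction of the `i`-th
axis. It is obtained by cutting `A` into slabs of height `δ`: the sweep of each piece stays in a
slab of height `2 δ` above the projection of that piece. -/
lemma lintegral_sweep_le {n : ℕ} (i : Fin (n + 1)) {A : Set (E (n + 1))} (hA : MeasurableSet A)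
    {δ : ℝ} (hδ : 0 < δ) {L : ℝ≥0} {h : E (n + 1) → ℝ} (hL : LipschitzWith L h) :
    ∫⁻ x in {x | ∃ s ∈ Set.Icc 0 δ, x - s • EuclideanSpace.single i (1 : ℝ) ∈ A}, ‖h x‖ₑ
      ≤ ENNReal.ofReal (2 * δ) * ∫⁻ x in A, (‖h x‖ₑ + ENNReal.ofReal (2 * L * δ))
          ∂(Measure.euclideanHausdorffMeasure n) := by
  set e : E (n + 1) := EuclideanSpace.single i (1 : ℝ) with he
  have hei : e i = 1 := by simp [he]
  have hnorm : ‖e‖ = 1 := by simp [he]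
  have hcoord : Measurable fun x : E (n + 1) => x i := by fun_prop
  -- The pieces `S j` of `A` are disjoint; `T j` is a slab of height `2 δ` containing the sweep
  -- of `S j`.
  let S : ℤ → Set (E (n + 1)) := fun j => A ∩ {x | ⌊x i / δ⌋ = j}
  have hSm : ∀ j, MeasurableSet (S j) := fun j =>
    hA.inter ((hcoord.div_const δ).floor (measurableSet_singleton j))
  have hSd : Pairwise (Function.onFun Disjoint S) := by
    intro j k hjk
    refine Set.disjoint_left.2 fun x hx hx' => hjk ?_
    exact hx.2.symm.trans hx'.2
  have hSU : ⋃ j, S j = A := by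
    ext x
    simp [S]
  have hSmem : ∀ j, ∀ x ∈ S j, j * δ ≤ x i ∧ x i < (j + 1) * δ := by
    rintro j x ⟨-, hx⟩
    have := Int.floor_eq_iff.1 hx
    exact ⟨(le_div_iff₀ hδ).1 this.1, (div_lt_iff₀ hδ).1 this.2⟩
  let T : ℤ → Set (E (n + 1)) := fun j =>
    {x | x i ∈ Set.Ico (j * δ) ((j + 2) * δ) ∧ dropCoord i x ∈ dropCoord i '' S j}
  have hcover : {x | ∃ s ∈ Set.Icc 0 δ, x - s • e ∈ A} ⊆ ⋃ j, T j := by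
    rintro x ⟨s, hs, hx⟩
    have hxS : x - s • e ∈ S ⌊(x - s • e) i / δ⌋ := ⟨hx, rfl⟩
    have hb := hSmem _ _ hxS
    simp only [PiLp.sub_apply, PiLp.smul_apply, hei, smul_eq_mul, mul_one] at hb
    refine Set.mem_iUnion.2 ⟨_, ⟨?_, ?_⟩, _, hxS, ?_⟩
    · simp only [PiLp.sub_apply, PiLp.smul_apply, hei, smul_eq_mul, mul_one]
      linarith [hs.1]
    · simp only [PiLp.sub_apply, PiLp.smul_apply, hei, smul_eq_mul, mul_one]
      linarith [hs.2]
    · ext k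
      simp [dropCoord, he, Fin.succAbove_ne]
  have hslab : ∀ j, ∫⁻ x in T j, ‖h x‖ₑ ≤ ENNReal.ofReal (2 * δ) *
      ∫⁻ x in S j, (‖h x‖ₑ + ENNReal.ofReal (2 * L * δ))
        ∂(Measure.euclideanHausdorffMeasure n) := by
    intro j
    refine (lintegral_slab_le i (S j) _ _ hL.continuous.measurable.enorm).trans ?_
    have hbound : ∀ t ∈ Set.Ico (j * δ) ((j + 2) * δ),
        ∫⁻ x in S j, ‖h (x + (t - x i) • e)‖ₑ ∂(Measure.euclideanHausdorffMeasure n)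
          ≤ ∫⁻ x in S j, (‖h x‖ₑ + ENNReal.ofReal (2 * L * δ))
            ∂(Measure.euclideanHausdorffMeasure n) := by
      intro t ht
      refine setLIntegral_mono' (hSm j) fun x hx => ?_
      have hb := hSmem j x hx
      have habs : |t - x i| ≤ 2 * δ := by
        rw [abs_le]
        constructor <;> nlinarith [ht.1, ht.2]
      have h1 : ‖h (x + (t - x i) • e) - h x‖ ≤ 2 * L * δ := by
        have h2 := hL.dist_le_mul (x + (t - x i) • e) x
        rw [dist_eq_norm, dist_eq_norm, add_sub_cancel_left, norm_smul, hnorm, mul_one,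
          Real.norm_eq_abs (t - x i)] at h2
        nlinarith [mul_le_mul_of_nonneg_left habs L.coe_nonneg]
      calc ‖h (x + (t - x i) • e)‖ₑ
          = ‖h x + (h (x + (t - x i) • e) - h x)‖ₑ := by rw [add_sub_cancel]
        _ ≤ ‖h x‖ₑ + ‖h (x + (t - x i) • e) - h x‖ₑ := enorm_add_le _ _
        _ ≤ _ := by
          gcongr
          rw [← ofReal_norm]
          exact ENNReal.ofReal_le_ofReal h1
    refine (setLIntegral_mono' measurableSet_Ico hbound).trans_eq ?_
    rw [setLIntegral_const, Real.volume_Ico, mul_comm]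
    congr 2
    ring
  calc ∫⁻ x in {x | ∃ s ∈ Set.Icc 0 δ, x - s • e ∈ A}, ‖h x‖ₑ
      ≤ ∫⁻ x in ⋃ j, T j, ‖h x‖ₑ := lintegral_mono_set hcover
    _ ≤ ∑' j, ∫⁻ x in T j, ‖h x‖ₑ := lintegral_iUnion_le _ _
    _ ≤ ∑' j, ENNReal.ofReal (2 * δ) * ∫⁻ x in S j, (‖h x‖ₑ + ENNReal.ofReal (2 * L * δ))
          ∂(Measure.euclideanHausdorffMeasure n) := ENNReal.tsum_le_tsum hslab
    _ = _ := by
      rw [ENNReal.tsum_mul_left, ← lintegral_iUnion hSm hSd, hSU]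

/-- A segment joining a point of an open set to a point outside of it meets the frontier. -/
lemma exists_mem_segment_mem_frontier {V : Type*} [NormedAddCommGroup V] [NormedSpace ℝ V]
    {Ω : Set V} (hΩ : IsOpen Ω) {x y : V} (hx : x ∈ Ω) (hy : y ∉ Ω) :
    ∃ z ∈ segment ℝ x y, z ∈ frontier Ω := by
  by_contra! hne
  have hsub : segment ℝ x y ⊆ Ω ∪ (closure Ω)ᶜ := by
    intro z hz
    by_cases hzΩ : z ∈ Ω
    · exact Or.inl hzΩ
    · refine Or.inr fun hzc => hne z hz ?_
      rw [hΩ.frontier_eq]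
      exact ⟨hzc, hzΩ⟩
  have hd : Disjoint Ω (closure Ω)ᶜ :=
    Set.disjoint_left.2 fun z hz hz' => hz' (subset_closure hz)
  have := (convex_segment x y).isPreconnected.subset_left_of_subset_union hΩ
    isClosed_closure.isOpen_compl hd hsub ⟨x, left_mem_segment ℝ x y, hx⟩
  exact hy (this (right_mem_segment ℝ x y))

open scoped Pointwise in
/-- The change of `∫_Ω h` under a translation by `δ eᵢ` is controlled by the integral of `|h|` over
the sweep of the boundary. -/
lemma enorm_integral_translate_sub_le {n : ℕ} (i : Fin (n + 1)) {Ω : Set (E (n + 1))}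
    (hΩ : IsOpen Ω) {δ : ℝ} (hδ : 0 ≤ δ) {h : E (n + 1) → ℝ} (hc : Continuous h)
    (hcs : HasCompactSupport h) :
    ‖∫ x in Ω, (h (x + δ • EuclideanSpace.single i (1 : ℝ)) - h x)‖ₑ
      ≤ ∫⁻ x in {x | ∃ s ∈ Set.Icc 0 δ,
          x - s • EuclideanSpace.single i (1 : ℝ) ∈ frontier Ω}, ‖h x‖ₑ := by
  set e : E (n + 1) := EuclideanSpace.single i (1 : ℝ)
  set N := {x | ∃ s ∈ Set.Icc 0 δ, x - s • e ∈ frontier Ω}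
  have hint : Integrable h := hc.integrable_of_hasCompactSupport hcs
  have hint' : Integrable fun x => h (x + δ • e) := hint.comp_add_right _
  have hΩm := hΩ.measurableSet
  have hNclosed : IsClosed N := by
    have hN : N = frontier Ω + (fun s : ℝ => s • e) '' Set.Icc (0 : ℝ) δ := by
      ext x
      constructor
      · rintro ⟨s, hs, hx⟩
        exact ⟨x - s • e, hx, s • e, ⟨s, hs, rfl⟩, sub_add_cancel _ _⟩
      · rintro ⟨z, hz, _, ⟨s, hs, rfl⟩, rfl⟩
        exact ⟨s, hs, by simpa using hz⟩
    rw [hN]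
    exact isClosed_frontier.add_right_of_isCompact (isCompact_Icc.image (by fun_prop))
  -- Move the translation from `h` to the indicator function of `Ω`.
  have h1 : ∫ x in Ω, h (x + δ • e) = ∫ x, ((fun x => x - δ • e) ⁻¹' Ω).indicator h x := by
    rw [← integral_indicator hΩm,
      ← integral_add_right_eq_self (fun x => ((fun x => x - δ • e) ⁻¹' Ω).indicator h x) (δ • e)]
    congr 1 with x
    by_cases hx : x ∈ Ω <;> simp [Set.indicator, hx]
  have hΩm' : MeasurableSet ((fun x => x - δ • e) ⁻¹' Ω) :=
    (hΩ.preimage (by fun_prop)).measurableSet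
  rw [integral_sub hint'.integrableOn hint.integrableOn, h1, ← integral_indicator hΩm,
    ← integral_sub (hint.indicator hΩm') (hint.indicator hΩm)]
  refine (enorm_integral_le_lintegral_enorm _).trans ?_
  rw [← lintegral_indicator hNclosed.measurableSet]
  refine lintegral_mono fun x => ?_
  by_cases hxN : x ∈ N
  · rw [Set.indicator_of_mem hxN]
    by_cases hx1 : x ∈ (fun x => x - δ • e) ⁻¹' Ω <;> by_cases hx2 : x ∈ Ω <;>
      simp [hx1, hx2]
  · have hiff : x - δ • e ∈ Ω ↔ x ∈ Ω := by
      by_contra hcon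
      apply hxN
      have hz : ∃ z ∈ segment ℝ x (x - δ • e), z ∈ frontier Ω := by
        by_cases hx2 : x ∈ Ω
        · exact exists_mem_segment_mem_frontier hΩ hx2 (by tauto)
        · obtain ⟨z, hz, hzf⟩ := exists_mem_segment_mem_frontier hΩ
            (by tauto : x - δ • e ∈ Ω) hx2
          exact ⟨z, by rwa [segment_symm], hzf⟩
      obtain ⟨z, hz, hzf⟩ := hz
      rw [segment_eq_image'] at hz
      obtain ⟨θ, hθ, rfl⟩ := hz
      refine ⟨θ * δ, ⟨mul_nonneg hθ.1 hδ, by nlinarith [hθ.2]⟩, ?_⟩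
      convert hzf using 1
      module
    by_cases hx2 : x ∈ Ω <;> simp [Set.indicator, hiff, hx2]

/-- **Boundary estimate.** For a bounded open set whose boundary has finite Hausdorff measure, the
integral of a partial derivative is controlled by the boundary values. This replaces the divergence
theorem, of which only the size of the boundary term matters. -/
lemma enorm_integral_partialDeriv_le {n : ℕ} (i : Fin (n + 1)) {Ω : Set (E (n + 1))}
    (hΩ : IsOpen Ω) (hb : Bornology.IsBounded Ω) (hσ : surf Ω Set.univ ≠ ⊤)
    {h : E (n + 1) → ℝ} (hc : ContDiff ℝ 1 h) (hcs : HasCompactSupport h) :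
    ‖∫ x in Ω, fderiv ℝ h x (EuclideanSpace.single i 1)‖ₑ ≤ 2 * ∫⁻ x, ‖h x‖ₑ ∂(surf Ω) := by
  obtain ⟨L, hL⟩ := ContDiff.lipschitzWith_of_hasCompactSupport hcs hc one_ne_zero
  set e : E (n + 1) := EuclideanSpace.single i (1 : ℝ) with he
  have hnorm : ‖e‖ = 1 := by simp [he]
  let δ : ℕ → ℝ := fun k => ((k : ℝ) + 1)⁻¹
  have hδpos : ∀ k, 0 < δ k := fun k => by positivity
  have hδ0 : Tendsto δ atTop (𝓝 0) := by
    simpa [δ, one_div] using tendsto_one_div_add_atTop_nhds_zero_nat (𝕜 := ℝ)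
  have hlim : Tendsto (fun k => ∫ x in Ω, (δ k)⁻¹ • (h (x + δ k • e) - h x)) atTop
      (𝓝 (∫ x in Ω, fderiv ℝ h x e)) := by
    refine tendsto_integral_of_dominated_convergence (fun _ => (L : ℝ)) (fun k => ?_) ?_
      (fun k => ?_) ?_
    · have := hc.continuous
      exact Continuous.aestronglyMeasurable (by fun_prop)
    · have : IsFiniteMeasure (vol Ω) := ⟨by simpa using hb.measure_lt_top⟩
      exact integrable_const _
    · refine Eventually.of_forall fun x => ?_
      have h2 := hL.dist_le_mul (x + δ k • e) x
      rw [dist_eq_norm, dist_eq_norm, add_sub_cancel_left, norm_smul, hnorm, mul_one,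
        Real.norm_of_nonneg (hδpos k).le] at h2
      rw [norm_smul, norm_inv, Real.norm_of_nonneg (hδpos k).le, inv_mul_le_iff₀ (hδpos k)]
      linarith
    · refine Eventually.of_forall fun x => ?_
      have hd := ((hc.differentiable one_ne_zero x).hasFDerivAt).hasLineDerivAt e
      have hs := hd.tendsto_slope_zero
      refine hs.comp (tendsto_nhdsWithin_iff.2 ⟨hδ0, Eventually.of_forall fun k => ?_⟩)
      exact (hδpos k).ne'
  have hbound : ∀ k, ‖∫ x in Ω, (δ k)⁻¹ • (h (x + δ k • e) - h x)‖ₑ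
      ≤ 2 * (∫⁻ x, ‖h x‖ₑ ∂(surf Ω) + ENNReal.ofReal (2 * L * δ k) * surf Ω Set.univ) := by
    intro k
    rw [integral_smul, enorm_smul]
    have h1 := (enorm_integral_translate_sub_le i hΩ (hδpos k).le hc.continuous hcs).trans
      (lintegral_sweep_le i isClosed_frontier.measurableSet (hδpos k) hL)
    rw [lintegral_add_right _ measurable_const, lintegral_const] at h1
    calc ‖(δ k)⁻¹‖ₑ * _ ≤ ‖(δ k)⁻¹‖ₑ * (ENNReal.ofReal (2 * δ k) *
          (∫⁻ x, ‖h x‖ₑ ∂(surf Ω) + ENNReal.ofReal (2 * L * δ k) * surf Ω Set.univ)) := by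
          gcongr
          exact h1
      _ = _ := by
        rw [← mul_assoc, Real.enorm_eq_ofReal (by have := hδpos k; positivity),
          ← ENNReal.ofReal_mul (by have := hδpos k; positivity)]
        congr 1
        rw [show (δ k)⁻¹ * (2 * δ k) = 2 by have := (hδpos k).ne'; field_simp]
        simp
  refine le_of_tendsto_of_tendsto' hlim.enorm ?_ hbound
  have h3 : Tendsto (fun k => ENNReal.ofReal (2 * L * δ k) * surf Ω Set.univ) atTop (𝓝 0) := by
    have : Tendsto (fun k => ENNReal.ofReal (2 * L * δ k)) atTop (𝓝 0) := by
      simpa using ENNReal.tendsto_ofReal (hδ0.const_mul (2 * (L : ℝ)))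
    simpa using ENNReal.Tendsto.mul_const this (Or.inr hσ)
  simpa using ENNReal.Tendsto.const_mul (tendsto_const_nhds.add h3) (Or.inr (by simp))

/-! ### Finite surface measure and extension by zero -/

/-- The boundary of a bounded Lipschitz domain has finite surface measure: it is compact, and
locally it is contained in the graph of a Lipschitz function. -/
lemma IsBoundedLipschitzDomain.surf_univ_lt_top {n : ℕ} {Ω : Set (E (n + 1))}
    (hΩ : IsBoundedLipschitzDomain Ω) : surf Ω Set.univ < ⊤ := by
  rw [Measure.restrict_apply_univ, Nat.add_sub_cancel]
  have hcpt : IsCompact (frontier Ω) :=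
    Metric.isCompact_of_isClosed_isBounded isClosed_frontier
      (hΩ.isBounded.closure.subset frontier_subset_closure)
  refine hcpt.measure_lt_top_of_nhdsWithin fun x₀ hx₀ => ?_
  obtain ⟨e, he, L, γ, hγ, U, hU, hUΩ⟩ := hΩ.lipschitz_boundary x₀ hx₀
  obtain ⟨V, hVU, hVo, hxV⟩ := mem_nhds_iff.1 hU
  have hfin : Module.finrank ℝ (ℝ ∙ e)ᗮ = n := by
    have : Fact (Module.finrank ℝ (E (n + 1)) = n + 1) := ⟨by simp⟩
    exact Submodule.finrank_orthogonal_span_singleton (by rintro rfl; simp at he)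
  let Φ : (ℝ ∙ e)ᗮ → E (n + 1) := fun y => (y : E (n + 1)) + γ y • e
  have hΦ : LipschitzWith (1 + L) Φ := by
    refine LipschitzWith.of_dist_le_mul fun y z => ?_
    have h1 := hγ.dist_le_mul y z
    rw [Real.dist_eq] at h1
    have h2 : Φ y - Φ z = ((y - z : (ℝ ∙ e)ᗮ) : E (n + 1)) + (γ y - γ z) • e := by
      simp only [Φ, Submodule.coe_sub]
      module
    rw [dist_eq_norm, h2]
    refine (norm_add_le _ _).trans ?_
    rw [norm_smul, he, mul_one, ← Submodule.coe_norm, ← dist_eq_norm y z, NNReal.coe_add,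
      NNReal.coe_one, Real.norm_eq_abs]
    linarith
  let B : Set (ℝ ∙ e)ᗮ := Metric.closedBall ((ℝ ∙ e)ᗮ.orthogonalProjectionOnto x₀) 1
  have hgraph : frontier Ω ∩ (V ∩ Metric.ball x₀ 1) ⊆ Φ '' B := by
    rintro x ⟨hxf, hxV', hxb⟩
    have hxΩ : x ∉ Ω := by
      rw [hΩ.isOpen.frontier_eq] at hxf
      exact hxf.2
    have hle : inner ℝ e x ≤ γ ((ℝ ∙ e)ᗮ.orthogonalProjectionOnto x) := by
      by_contra! hlt
      exact hxΩ ((hUΩ x (hVU hxV')).2 hlt)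
    -- Points strictly below the graph are exterior points.
    have hge : γ ((ℝ ∙ e)ᗮ.orthogonalProjectionOnto x) ≤ inner ℝ e x := by
      by_contra! hlt
      have hopen : IsOpen {z | inner ℝ e z < γ ((ℝ ∙ e)ᗮ.orthogonalProjectionOnto z)} := by
        have := hγ.continuous
        exact isOpen_lt (by fun_prop) (by fun_prop)
      have hnhd := (hopen.inter hVo).mem_nhds ⟨hlt, hxV'⟩
      obtain ⟨z, ⟨hz1, hz2⟩, hzΩ⟩ := mem_closure_iff_nhds.1 (frontier_subset_closure hxf) _ hnhd
      exact lt_asymm hz1 ((hUΩ z (hVU hz2)).1 hzΩ)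
    refine ⟨(ℝ ∙ e)ᗮ.orthogonalProjectionOnto x, ?_, ?_⟩
    · have := (ℝ ∙ e)ᗮ.lipschitzWith_orthogonalProjectionOnto.dist_le_mul x x₀
      rw [NNReal.coe_one, one_mul] at this
      exact this.trans (Metric.mem_ball.1 hxb).le
    · have h1 := Submodule.starProjection_add_starProjection_orthogonal (K := ℝ ∙ e) x
      rw [Submodule.starProjection_unit_singleton ℝ he, Submodule.starProjection_apply] at h1
      change (((ℝ ∙ e)ᗮ.orthogonalProjectionOnto x : (ℝ ∙ e)ᗮ) : E (n + 1))
        + γ ((ℝ ∙ e)ᗮ.orthogonalProjectionOnto x) • e = x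
      rw [le_antisymm hge hle]
      exact (add_comm _ _).trans h1
  refine ⟨frontier Ω ∩ (V ∩ Metric.ball x₀ 1), inter_mem_nhdsWithin _
    (inter_mem (hVo.mem_nhds hxV) (Metric.ball_mem_nhds _ one_pos)), ?_⟩
  refine (measure_mono hgraph).trans_lt ?_
  rw [Measure.euclideanHausdorffMeasure_def, Measure.smul_apply]
  refine ENNReal.mul_lt_top (by simp) ?_
  refine (hΦ.hausdorffMeasure_image_le (d := n) (by positivity) B).trans_lt ?_
  refine ENNReal.mul_lt_top (by simp) ?_
  rw [show (n : ℝ) = (Module.finrank ℝ (ℝ ∙ e)ᗮ : ℕ) by rw [hfin]]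
  exact (isCompact_closedBall _ _).measure_lt_top

/-- A function continuous on the whole space belongs to every `L^q(Ω)`, for bounded `Ω`. -/
lemma memLp_vol_of_continuous {d : ℕ} {Ω : Set (E d)} (hb : Bornology.IsBounded Ω)
    {F : Type*} [NormedAddCommGroup F] [SecondCountableTopology F] {f : E d → F}
    (hf : Continuous f) (q : ℝ≥0∞) : MemLp f q (vol Ω) := by
  have : IsFiniteMeasure (vol Ω) := ⟨by simpa using hb.measure_lt_top⟩
  obtain ⟨C, hC⟩ := hb.isCompact_closure.exists_bound_of_continuousOn hf.continuousOn
  refine MemLp.of_bound hf.aestronglyMeasurable C ?_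
  refine ae_mono (Measure.restrict_mono subset_closure le_rfl) ?_
  exact ae_restrict_of_forall_mem isClosed_closure.measurableSet hC

lemma tendsto_integral_mul {α : Type*} [MeasurableSpace α] {μ : Measure α} {φ : ℕ → α → ℝ}
    {v ψ : α → ℝ} (hφ : ∀ k, MemLp (φ k) 2 μ) (hv : MemLp v 2 μ) (hψ : MemLp ψ 2 μ)
    (h : Tendsto (fun k => eLpNorm (fun x => φ k x - v x) 2 μ) atTop (𝓝 0)) :
    Tendsto (fun k => ∫ x, φ k x * ψ x ∂μ) atTop (𝓝 (∫ x, v x * ψ x ∂μ)) := by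
  have hint : ∀ w : α → ℝ, MemLp w 2 μ → Integrable (fun x => w x * ψ x) μ :=
    fun w hw => hw.integrable_mul hψ
  refine tendsto_integral_of_L1' (fun x => v x * ψ x) (hint v hv).aestronglyMeasurable
    (Eventually.of_forall fun k => hint _ (hφ k)) ?_
  have h0 : Tendsto (fun k => eLpNorm (fun x => φ k x - v x) 2 μ * eLpNorm ψ 2 μ) atTop (𝓝 0) := by
    simpa using ENNReal.Tendsto.mul_const h (Or.inr hψ.eLpNorm_ne_top)
  refine tendsto_of_tendsto_of_tendsto_of_le_of_le tendsto_const_nhds h0 (fun _ => zero_le) ?_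
  intro k
  have h1 := eLpNorm_smul_le_mul_eLpNorm (p := 2) (q := 2) (r := 1) hψ.aestronglyMeasurable
    ((hφ k).sub hv).aestronglyMeasurable
  have h2 : (fun x => φ k x * ψ x) - (fun x => v x * ψ x) = (φ k - v) • ψ := by
    ext x
    simp [sub_mul]
  beta_reduce
  rw [h2]
  exact h1

lemma gradient_apply {d : ℕ} (f : E d → ℝ) (x : E d) (i : Fin d) :
    gradient f x i = fderiv ℝ f x (EuclideanSpace.single i 1) := by
  rw [← inner_gradient_left, real_inner_comm, EuclideanSpace.inner_single_left]
  simp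

lemma continuous_gradient {d : ℕ} {f : E d → ℝ} (hf : ContDiff ℝ 1 f) :
    Continuous (gradient f) :=
  (InnerProductSpace.toDual ℝ (E d)).symm.continuous.comp (hf.continuous_fderiv one_ne_zero)

lemma MemLp.coord {d : ℕ} {μ : Measure (E d)} {G : E d → E d} {q : ℝ≥0∞} (hG : MemLp G q μ)
    (i : Fin d) : MemLp (fun x => G x i) q μ := by
  refine hG.of_le ?_ (Eventually.of_forall fun x => PiLp.norm_apply_le _ i)
  exact (PiLp.continuous_apply 2 _ i).comp_aestronglyMeasurable hG.aestronglyMeasurable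

lemma eLpNorm_coord_le {d : ℕ} {μ : Measure (E d)} (G : E d → E d) (q : ℝ≥0∞) (i : Fin d) :
    eLpNorm (fun x => G x i) q μ ≤ eLpNorm G q μ :=
  eLpNorm_mono fun _ => PiLp.norm_apply_le _ i

/-- Passing to the limit in the approximation of an `H¹` function by smooth functions, against a
test function which need not vanish near the boundary. -/
lemma tendsto_integral_partialDeriv_mul {d : ℕ} {Ω : Set (E d)} (hb : Bornology.IsBounded Ω)
    {u : E d → ℝ} {G : E d → E d} (hu : MemLp u 2 (vol Ω)) (hG : MemLp G 2 (vol Ω))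
    {φ : ℕ → E d → ℝ} (hφ : ∀ k, ContDiff ℝ 1 (φ k))
    (hφu : Tendsto (fun k => eLpNorm (fun x => φ k x - u x) 2 (vol Ω)) atTop (𝓝 0))
    (hφG : Tendsto (fun k => eLpNorm (fun x => gradient (φ k) x - G x) 2 (vol Ω)) atTop (𝓝 0))
    {ψ : E d → ℝ} (hψ : ContDiff ℝ 1 ψ) (i : Fin d) :
    Tendsto (fun k => ∫ x in Ω, fderiv ℝ (fun y => φ k y * ψ y) x (EuclideanSpace.single i 1))
      atTop (𝓝 ((∫ x in Ω, u x * fderiv ℝ ψ x (EuclideanSpace.single i 1))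
        + ∫ x in Ω, G x i * ψ x)) := by
  have hψ' : Continuous fun x => fderiv ℝ ψ x (EuclideanSpace.single i 1) :=
    (hψ.continuous_fderiv one_ne_zero).clm_apply continuous_const
  have hmψ := memLp_vol_of_continuous hb hψ.continuous 2
  have hmψ' := memLp_vol_of_continuous hb hψ' 2
  have hmφ := fun k => memLp_vol_of_continuous hb (hφ k).continuous 2
  have hmG := fun k => memLp_vol_of_continuous hb (continuous_gradient (hφ k)) 2
  have h1 := tendsto_integral_mul hmφ hu hmψ' hφu
  have h2 := tendsto_integral_mul (φ := fun k x => gradient (φ k) x i)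
    (fun k => MemLp.coord (hmG k) i) (MemLp.coord hG i) hmψ
    (tendsto_of_tendsto_of_tendsto_of_le_of_le tendsto_const_nhds hφG (fun _ => zero_le)
      fun k => eLpNorm_coord_le (fun x => gradient (φ k) x - G x) 2 i)
  refine (h1.add h2).congr fun k => ?_
  have hi1 : Integrable (fun x => φ k x * fderiv ℝ ψ x (EuclideanSpace.single i 1)) (vol Ω) :=
    (hmφ k).integrable_mul hmψ'
  have hi2 : Integrable (fun x => gradient (φ k) x i * ψ x) (vol Ω) :=
    (MemLp.coord (hmG k) i).integrable_mul hmψ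
  rw [← integral_add hi1 hi2]
  refine integral_congr_ae (Eventually.of_forall fun x => ?_)
  have hd1 := (hφ k).differentiable one_ne_zero x
  have hd2 := hψ.differentiable one_ne_zero x
  simp only [fderiv_fun_mul hd1 hd2, gradient_apply]
  simp
  ring

/-- A function of `H¹(Ω)` with zero trace, extended by zero, has a weak gradient on the whole
space: integration by parts holds for test functions which do not vanish near the boundary. -/
lemma integral_mul_partialDeriv_of_trace_zero {n : ℕ} {Ω : Set (E (n + 1))} (hΩ : IsOpen Ω)
    (hb : Bornology.IsBounded Ω) (hσ : surf Ω Set.univ < ⊤) {v : E (n + 1) → ℝ}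
    {G : E (n + 1) → E (n + 1)} (hv : MemLp v 2 (vol Ω)) (hG : MemLp G 2 (vol Ω))
    {φ : ℕ → E (n + 1) → ℝ} (hφ : ∀ k, ContDiff ℝ 1 (φ k))
    (hφu : Tendsto (fun k => eLpNorm (fun x => φ k x - v x) 2 (vol Ω)) atTop (𝓝 0))
    (hφG : Tendsto (fun k => eLpNorm (fun x => gradient (φ k) x - G x) 2 (vol Ω)) atTop (𝓝 0))
    (hφg : Tendsto (fun k => eLpNorm (φ k) 2 (surf Ω)) atTop (𝓝 0)) {ψ : E (n + 1) → ℝ}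
    (hψ : ContDiff ℝ 1 ψ) (hψc : HasCompactSupport ψ) (i : Fin (n + 1)) :
    ∫ x in Ω, v x * fderiv ℝ ψ x (EuclideanSpace.single i 1) = -∫ x in Ω, G x i * ψ x := by
  have hlim := tendsto_integral_partialDeriv_mul hb hv hG hφ hφu hφG hψ i
  obtain ⟨C, hC⟩ := hψc.exists_bound_of_continuous hψ.continuous
  have hbd : ∀ k, ‖∫ x in Ω, fderiv ℝ (fun y => φ k y * ψ y) x (EuclideanSpace.single i 1)‖ₑ
      ≤ 2 * (ENNReal.ofReal C * (eLpNorm (φ k) 2 (surf Ω)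
        * surf Ω Set.univ ^ (1 / 2 : ℝ))) := by
    intro k
    refine (enorm_integral_partialDeriv_le i hΩ hb hσ.ne ((hφ k).mul hψ) hψc.mul_left).trans ?_
    gcongr
    calc ∫⁻ x, ‖φ k x * ψ x‖ₑ ∂(surf Ω) ≤ ∫⁻ x, ENNReal.ofReal C * ‖φ k x‖ₑ ∂(surf Ω) := by
          refine lintegral_mono fun x => ?_
          rw [enorm_mul, mul_comm]
          gcongr
          rw [← ofReal_norm]
          exact ENNReal.ofReal_le_ofReal (hC x)
      _ = ENNReal.ofReal C * eLpNorm (φ k) 1 (surf Ω) := by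
          rw [lintegral_const_mul _ (hφ k).continuous.measurable.enorm,
            eLpNorm_one_eq_lintegral_enorm]
      _ ≤ _ := by
          gcongr
          have := eLpNorm_le_eLpNorm_mul_rpow_measure_univ (p := 1) (q := 2) (μ := surf Ω)
            one_le_two (hφ k).continuous.aestronglyMeasurable
          refine this.trans_eq ?_
          norm_num
  have hzero : Tendsto (fun k => 2 * (ENNReal.ofReal C *
      (eLpNorm (φ k) 2 (surf Ω)
        * surf Ω Set.univ ^ (1 / 2 : ℝ)))) atTop (𝓝 0) := by
    have h1 := ENNReal.Tendsto.mul_const hφg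
      (Or.inr (ENNReal.rpow_lt_top_of_nonneg (by norm_num : (0 : ℝ) ≤ 1 / 2) hσ.ne).ne)
    have h2 := ENNReal.Tendsto.const_mul (a := ENNReal.ofReal C) h1 (Or.inr (by simp))
    simpa using ENNReal.Tendsto.const_mul (a := 2) h2 (Or.inr (by simp))
  have h0 := le_of_tendsto_of_tendsto' hlim.enorm hzero hbd
  have h1 : (∫ x in Ω, v x * fderiv ℝ ψ x (EuclideanSpace.single i 1))
      + ∫ x in Ω, G x i * ψ x = 0 := by
    simpa using h0
  linarith

/-! ### Mollification and the Poincaré–Sobolev inequality -/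

/-- Averaging against a probability density does not increase the `L²` norm. -/
lemma eLpNorm_mollify_le {d : ℕ} {ρ : E d → ℝ} (hρ : Continuous ρ) (hρ0 : ∀ x, 0 ≤ ρ x)
    (hρi : Integrable ρ) (hρ1 : ∫ x, ρ x = 1) {g : E d → ℝ} (hg : AEStronglyMeasurable g) :
    eLpNorm (fun x => ∫ t, g t * ρ (x - t)) 2 volume ≤ eLpNorm g 2 volume := by
  have hmass : ∫⁻ x, ENNReal.ofReal (ρ x) = 1 := by
    rw [← ofReal_integral_eq_lintegral_ofReal hρi (Eventually.of_forall hρ0), hρ1,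
      ENNReal.ofReal_one]
  have hsq : ∀ f : E d → ℝ, ∀ μ : Measure (E d), eLpNorm f 2 μ ^ 2 = ∫⁻ x, ‖f x‖ₑ ^ 2 ∂μ := by
    intro f μ
    simpa using eLpNorm_nnreal_pow_eq_lintegral (f := f) (p := 2) (μ := μ) two_ne_zero
  have hmeas : ∀ x, Measurable fun t => ENNReal.ofReal (ρ (x - t)) := fun x =>
    (hρ.comp (by fun_prop)).measurable.ennreal_ofReal
  -- Jensen's inequality for the probability measure with density `t ↦ ρ (x - t)`.
  have hpt : ∀ x, ‖∫ t, g t * ρ (x - t)‖ₑ ^ 2 ≤ ∫⁻ t, ENNReal.ofReal (ρ (x - t)) * ‖g t‖ₑ ^ 2 := by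
    intro x
    let ν : Measure (E d) := volume.withDensity fun t => ENNReal.ofReal (ρ (x - t))
    have hν : IsProbabilityMeasure ν := ⟨by
      rw [withDensity_apply _ MeasurableSet.univ, Measure.restrict_univ]
      rw [lintegral_sub_left_eq_self (fun t => ENNReal.ofReal (ρ t)) x, hmass]⟩
    have hgν : AEStronglyMeasurable g ν := hg.mono_ac (withDensity_absolutelyContinuous _ _)
    have h1 : ‖∫ t, g t * ρ (x - t)‖ₑ ≤ eLpNorm g 1 ν := by
      rw [eLpNorm_one_eq_lintegral_enorm,
        lintegral_withDensity_eq_lintegral_mul₀ (hmeas x).aemeasurable hg.enorm]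
      refine (enorm_integral_le_lintegral_enorm _).trans_eq ?_
      refine lintegral_congr fun t => ?_
      rw [enorm_mul, mul_comm, Real.enorm_eq_ofReal (hρ0 _)]
      rfl
    have h2 := h1.trans (eLpNorm_le_eLpNorm_of_exponent_le one_le_two hgν)
    calc _ ≤ eLpNorm g 2 ν ^ 2 := by gcongr
      _ = _ := by
        rw [hsq, lintegral_withDensity_eq_lintegral_mul₀ (hmeas x).aemeasurable
          (hg.enorm.pow_const 2)]
        rfl
  rw [← ENNReal.pow_le_pow_left_iff two_ne_zero, hsq, hsq]
  calc ∫⁻ x, ‖∫ t, g t * ρ (x - t)‖ₑ ^ 2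
      ≤ ∫⁻ x, ∫⁻ t, ENNReal.ofReal (ρ (x - t)) * ‖g t‖ₑ ^ 2 := lintegral_mono hpt
    _ = ∫⁻ t, ∫⁻ x, ENNReal.ofReal (ρ (x - t)) * ‖g t‖ₑ ^ 2 := by
      have h1 : Continuous fun q : E d × E d => ρ (q.1 - q.2) := hρ.comp (by fun_prop)
      have h2 : AEMeasurable (fun q : E d × E d => ‖g q.2‖ₑ ^ 2) (volume.prod volume) :=
        (hg.enorm.pow_const 2).comp_snd
      exact lintegral_lintegral_swap (h1.measurable.ennreal_ofReal.aemeasurable.mul h2)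
    _ = ∫⁻ t, ‖g t‖ₑ ^ 2 := by
      refine lintegral_congr fun t => ?_
      have h1 : Continuous fun x => ρ (x - t) := hρ.comp (by fun_prop)
      rw [lintegral_mul_const _ h1.measurable.ennreal_ofReal,
        lintegral_sub_right_eq_self (fun x => ENNReal.ofReal (ρ x)) t, hmass, one_mul]

lemma norm_le_sum_norm_apply_single {d : ℕ} (T : E d →L[ℝ] ℝ) :
    ‖T‖ ≤ ∑ i, ‖T (EuclideanSpace.single i 1)‖ := by
  refine T.opNorm_le_bound (Finset.sum_nonneg fun _ _ => norm_nonneg _) fun x => ?_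
  have hx : T x = ∑ i, x i * T (EuclideanSpace.single i 1) := by
    conv_lhs => rw [← (EuclideanSpace.basisFun (Fin d) ℝ).sum_repr x]
    simp
  rw [hx, Finset.sum_mul]
  refine (norm_sum_le _ _).trans (Finset.sum_le_sum fun i _ => ?_)
  rw [norm_mul, mul_comm]
  gcongr
  exact PiLp.norm_apply_le x i

lemma eLpNorm_le_mul_of_support_subset {d : ℕ} {f : E d → ℝ} {s : Set (E d)} {r : ℝ≥0}
    (hr : (r : ℝ≥0∞) ≤ 2) (hf : Continuous f) (hs : Function.support f ⊆ s) :
    eLpNorm f r volume ≤ eLpNorm f 2 volume * volume s ^ (1 / (r : ℝ) - 1 / 2) := by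
  have h := fun q : ℝ≥0∞ => eLpNorm_restrict_eq_of_support_subset (p := q) (μ := volume) hs
  rw [← h r, ← h 2]
  simpa using eLpNorm_le_eLpNorm_mul_rpow_measure_univ (μ := volume.restrict s) hr
    hf.aestronglyMeasurable

/-- The Gagliardo–Nirenberg–Sobolev inequality in the form used below. In dimension two the
exponent on the right is first lowered to `2 p / (p + 2) < 2`. -/
lemma exists_eLpNorm_le_eLpNorm_fderiv {d : ℕ} {p : ℝ} (hdp : (d = 2 ∧ 4 < p) ∨ (d = 3 ∧ p = 6))
    {s : Set (E d)} (hs : Bornology.IsBounded s) :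
    ∃ C : ℝ≥0, ∀ m : E d → ℝ, ContDiff ℝ 1 m → Function.support m ⊆ s →
      eLpNorm m (ENNReal.ofReal p) volume ≤ C * eLpNorm (fderiv ℝ m) 2 volume := by
  rcases hdp with ⟨rfl, hp⟩ | ⟨rfl, rfl⟩
  · have hp0 : 0 < p := by linarith
    let q : ℝ≥0 := ⟨p, hp0.le⟩
    -- The exponent with Sobolev conjugate `p`, that is, `1 / r - 1 / 2 = 1 / p`.
    let r : ℝ≥0 := ⟨2 * p / (p + 2), by positivity⟩
    have hr1 : 1 ≤ r := by
      rw [← NNReal.coe_le_coe]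
      change (1 : ℝ) ≤ 2 * p / (p + 2)
      rw [le_div_iff₀ (by linarith)]
      linarith
    have hr2 : (r : ℝ) < 2 := by
      change 2 * p / (p + 2) < 2
      rw [div_lt_iff₀ (by linarith)]
      linarith
    have hrq : (r : ℝ)⁻¹ - (Module.finrank ℝ (E 2) : ℝ)⁻¹ ≤ (q : ℝ)⁻¹ := by
      rw [finrank_euclideanSpace_fin]
      change (2 * p / (p + 2))⁻¹ - ((2 : ℕ) : ℝ)⁻¹ ≤ p⁻¹
      apply le_of_eq
      push_cast
      field_simp
      ring
    have hr2' : (r : ℝ≥0∞) ≤ 2 := by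
      have : r ≤ 2 := by
        rw [← NNReal.coe_le_coe]
        exact hr2.le
      exact_mod_cast this
    have hexp : 0 ≤ 1 / (r : ℝ) - 1 / 2 := by
      have := one_div_le_one_div_of_le (zero_lt_one.trans_le (NNReal.coe_le_coe.2 hr1)) hr2.le
      linarith
    have hfin : volume (closure s) ^ (1 / (r : ℝ) - 1 / 2) ≠ ⊤ :=
      (ENNReal.rpow_lt_top_of_nonneg hexp hs.isCompact_closure.measure_lt_top.ne).ne
    refine ⟨eLpNormLESNormFDerivOfLeConst ℝ volume s r q *
      (volume (closure s) ^ (1 / (r : ℝ) - 1 / 2)).toNNReal, fun m hm hms => ?_⟩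
    have h1 := eLpNorm_le_eLpNorm_fderiv_of_le (μ := volume) (F := ℝ) hm hms hr1
      (by rw [finrank_euclideanSpace_fin]; exact_mod_cast hr2) hrq hs
    have hsupp : (Function.support fun x => ‖fderiv ℝ m x‖) ⊆ closure s := by
      refine fun x hx => closure_mono hms (support_fderiv_subset ℝ (f := m) ?_)
      exact fun h0 => hx (norm_eq_zero.2 h0)
    have h2 : eLpNorm (fderiv ℝ m) r volume
        ≤ eLpNorm (fderiv ℝ m) 2 volume * volume (closure s) ^ (1 / (r : ℝ) - 1 / 2) := by
      rw [← eLpNorm_norm (fderiv ℝ m), ← eLpNorm_norm (fderiv ℝ m)]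
      exact eLpNorm_le_mul_of_support_subset hr2' (hm.continuous_fderiv one_ne_zero).norm hsupp
    have hq : ENNReal.ofReal p = q := ENNReal.ofReal_eq_coe_nnreal hp0.le
    rw [hq]
    refine h1.trans ?_
    push_cast
    rw [ENNReal.coe_toNNReal hfin, mul_assoc]
    gcongr
    rw [mul_comm]
    exact h2
  · refine ⟨eLpNormLESNormFDerivOfLeConst ℝ volume s 2 6, fun m hm hms => ?_⟩
    have h1 := eLpNorm_le_eLpNorm_fderiv_of_le (μ := volume) (F := ℝ) (p := 2) (q := 6) hm hms
      one_le_two (by rw [finrank_euclideanSpace_fin]; norm_num)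
      (by rw [finrank_euclideanSpace_fin]; norm_num) hs
    have h6 : ENNReal.ofReal 6 = ((6 : ℝ≥0) : ℝ≥0∞) := by simp
    rw [h6]
    exact_mod_cast h1

/-- The partial derivatives of a mollification of the zero extension of `v` are the mollifications
of the components of the weak gradient. -/
lemma MemH1g.fderiv_mollify {n : ℕ} {Ω : Set (E (n + 1))} (hΩ : IsOpen Ω)
    (hb : Bornology.IsBounded Ω) (hσ : surf Ω Set.univ < ⊤) {v : E (n + 1) → ℝ}
    {G : E (n + 1) → E (n + 1)} (hv : MemH1g Ω 0 v G) {ρ : E (n + 1) → ℝ} (hρ : ContDiff ℝ 1 ρ)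
    (hρc : HasCompactSupport ρ) :
    ContDiff ℝ 1 (fun x => ∫ t, Ω.indicator v t * ρ (x - t)) ∧
    ∀ x i, fderiv ℝ (fun x => ∫ t, Ω.indicator v t * ρ (x - t)) x (EuclideanSpace.single i 1)
      = ∫ t, Ω.indicator (fun t => G t i) t * ρ (x - t) := by
  have hΩm := hΩ.measurableSet
  have : IsFiniteMeasure (vol Ω) := ⟨by simpa using hb.measure_lt_top⟩
  have hloc : LocallyIntegrable (Ω.indicator v) volume :=
    (IntegrableOn.integrable_indicator (hv.hasH1Gradient.memLp.integrable one_le_two)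
      hΩm).locallyIntegrable
  have hconv : (fun x => ∫ t, Ω.indicator v t * ρ (x - t))
      = convolution (Ω.indicator v) ρ (ContinuousLinearMap.lsmul ℝ ℝ) volume := rfl
  have hcd : ContDiff ℝ 1 (fun x => ∫ t, Ω.indicator v t * ρ (x - t)) := by
    rw [hconv]
    exact hρc.contDiff_convolution_right (n := 1) _ hloc hρ
  refine ⟨hcd, fun x i => ?_⟩
  have hd := hρc.hasFDerivAt_convolution_right (ContinuousLinearMap.lsmul ℝ ℝ) hloc hρ x
  rw [hconv, hd.fderiv, convolution_precompR_apply _ hloc (hρc.fderiv ℝ)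
    (hρ.continuous_fderiv one_ne_zero)]
  let ψ : E (n + 1) → ℝ := fun t => ρ (x - t)
  have hψ : ContDiff ℝ 1 ψ := hρ.comp (by fun_prop)
  have hψc : HasCompactSupport ψ := hρc.comp_homeomorph (Homeomorph.subLeft x)
  have hψd : ∀ t, fderiv ℝ ψ t (EuclideanSpace.single i 1)
      = -fderiv ℝ ρ (x - t) (EuclideanSpace.single i 1) := by
    intro t
    have h1 : HasFDerivAt ψ ((fderiv ℝ ρ (x - t)).comp (-ContinuousLinearMap.id ℝ (E (n + 1)))) t :=
      (hρ.differentiable one_ne_zero (x - t)).hasFDerivAt.comp t ((hasFDerivAt_id t).const_sub x)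
    rw [h1.fderiv]
    simp
  obtain ⟨φ, hφ, hφu, hφG, hφg⟩ := hv.trace
  have hparts := integral_mul_partialDeriv_of_trace_zero hΩ hb hσ hv.hasH1Gradient.memLp
    hv.hasH1Gradient.memLp_grad (fun k => (hφ k).of_le (by simp)) hφu hφG (by simpa using hφg)
    hψ hψc i
  simp only [hψd, mul_neg, integral_neg, neg_inj] at hparts
  have hind : ∀ f h : E (n + 1) → ℝ, ∫ t, Ω.indicator f t * h t = ∫ t in Ω, f t * h t := by
    intro f h
    rw [← integral_indicator hΩm]
    congr 1 with t
    by_cases ht : t ∈ Ω <;> simp [ht]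
  rw [hind, ← hparts, ← hind]
  rfl

/-- The Poincaré–Sobolev inequality for functions of zero trace. -/
lemma exists_isPoincareSobolevConst {n : ℕ} {p : ℝ}
    (hdp : (n + 1 = 2 ∧ 4 < p) ∨ (n + 1 = 3 ∧ p = 6)) {Ω : Set (E (n + 1))}
    (hΩ : IsBoundedLipschitzDomain Ω) : ∃ K : ℝ, IsPoincareSobolevConst Ω p K := by
  have hb := hΩ.isBounded
  have hΩm := hΩ.isOpen.measurableSet
  have hσ := hΩ.surf_univ_lt_top
  have : IsFiniteMeasure (vol Ω) := ⟨by simpa using hb.measure_lt_top⟩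
  obtain ⟨C, hC⟩ := exists_eLpNorm_le_eLpNorm_fderiv hdp (hb.cthickening (δ := 1))
  refine ⟨C * (n + 1 : ℕ), by positivity, fun v G hv => ?_⟩
  let ρ : ℕ → ContDiffBump (0 : E (n + 1)) := fun k =>
    ⟨((k : ℝ) + 1)⁻¹ / 2, ((k : ℝ) + 1)⁻¹, by positivity, half_lt_self (by positivity)⟩
  have hρ0 : Tendsto (fun k => (ρ k).rOut) atTop (𝓝 0) := by
    simpa [ρ, one_div] using tendsto_one_div_add_atTop_nhds_zero_nat (𝕜 := ℝ)
  have hρ1 : ∀ k, (ρ k).rOut ≤ 1 := fun k => inv_le_one_of_one_le₀ (by simp)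
  let m : ℕ → E (n + 1) → ℝ := fun k x => ∫ t, Ω.indicator v t * (ρ k).normed volume (x - t)
  have hmoll := fun k => hv.fderiv_mollify hΩ.isOpen hb hσ
    (ρ := (ρ k).normed volume) ((ρ k).contDiff_normed (n := 1)) (ρ k).hasCompactSupport_normed
  have hloc : LocallyIntegrable (Ω.indicator v) volume :=
    (IntegrableOn.integrable_indicator (hv.hasH1Gradient.memLp.integrable one_le_two)
      hΩm).locallyIntegrable
  have hlim : ∀ᵐ x, Tendsto (fun k => m k x) atTop (𝓝 (Ω.indicator v x)) := by
    have h := ContDiffBump.ae_convolution_tendsto_right_of_locallyIntegrable (K := 2) hρ0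
      (Eventually.of_forall fun k => by simp [ρ]; linarith) hloc
    filter_upwards [h] with x hx
    refine hx.congr fun k => ?_
    rw [convolution_eq_swap]
    simp [m, mul_comm]
  have hsupp : ∀ k, Function.support (m k) ⊆ Metric.cthickening 1 Ω := by
    intro k x hx
    by_contra hcon
    refine hx (integral_eq_zero_of_ae (Eventually.of_forall fun t => ?_))
    by_cases ht : t ∈ Ω
    · have hz : (ρ k).normed volume (x - t) = 0 := by
        rw [← Function.notMem_support, (ρ k).support_normed_eq]
        intro hmem
        rw [mem_ball_zero_iff, ← dist_eq_norm] at hmem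
        exact hcon (Metric.mem_cthickening_of_dist_le x t 1 Ω ht (hmem.le.trans (hρ1 k)))
      simp [hz]
    · simp [ht]
  have hgrad : ∀ k, eLpNorm (fderiv ℝ (m k)) 2 volume ≤ (n + 1 : ℕ) * eLpNorm G 2 (vol Ω) := by
    intro k
    have hcomp : ∀ i, eLpNorm (fun x => fderiv ℝ (m k) x (EuclideanSpace.single i 1)) 2 volume
        ≤ eLpNorm G 2 (vol Ω) := by
      intro i
      have h1 : (fun x => fderiv ℝ (m k) x (EuclideanSpace.single i 1))
          = fun x => ∫ t, Ω.indicator (fun t => G t i) t * (ρ k).normed volume (x - t) :=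
        funext fun x => (hmoll k).2 x i
      have h2 := MemLp.coord hv.hasH1Gradient.memLp_grad i
      rw [h1]
      refine (eLpNorm_mollify_le (ρ k).continuous_normed (ρ k).nonneg_normed
        (ρ k).integrable_normed (ρ k).integral_normed
        ((aestronglyMeasurable_indicator_iff hΩm).2 h2.aestronglyMeasurable)).trans ?_
      rw [eLpNorm_indicator_eq_eLpNorm_restrict hΩm]
      exact eLpNorm_coord_le G 2 i
    have hmeas : ∀ i : Fin (n + 1),
        Continuous fun x => ‖fderiv ℝ (m k) x (EuclideanSpace.single i 1)‖ := fun i =>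
      (((hmoll k).1.continuous_fderiv one_ne_zero).clm_apply continuous_const).norm
    calc eLpNorm (fderiv ℝ (m k)) 2 volume
        ≤ eLpNorm (∑ i, fun x => ‖fderiv ℝ (m k) x (EuclideanSpace.single i 1)‖) 2 volume := by
          refine eLpNorm_mono_real fun x => ?_
          rw [Finset.sum_apply]
          exact norm_le_sum_norm_apply_single _
      _ ≤ ∑ i, eLpNorm (fun x => ‖fderiv ℝ (m k) x (EuclideanSpace.single i 1)‖) 2 volume :=
          eLpNorm_sum_le (fun i _ => (hmeas i).aestronglyMeasurable) one_le_two
      _ ≤ ∑ i : Fin (n + 1), eLpNorm G 2 (vol Ω) := by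
          refine Finset.sum_le_sum fun i _ => ?_
          rw [eLpNorm_norm]
          exact hcomp i
      _ = _ := by simp
  rw [← eLpNorm_indicator_eq_eLpNorm_restrict hΩm]
  refine (Lp.eLpNorm_lim_le_liminf_eLpNorm
    (fun k => (hmoll k).1.continuous.aestronglyMeasurable) _ hlim).trans ?_
  refine liminf_le_of_le (by isBoundedDefault) fun a ha => ?_
  obtain ⟨k, hk⟩ := ha.exists
  refine hk.trans (((hC (m k) (hmoll k).1 (hsupp k))).trans ?_)
  rw [ENNReal.ofReal_mul C.coe_nonneg, ENNReal.ofReal_coe_nnreal, ENNReal.ofReal_natCast, mul_assoc]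
  gcongr
  exact hgrad k

/-! ### Smooth truncations of Sobolev functions -/

/-- A smooth regularization of the truncation `s ↦ max (s - k) 0`: it vanishes for `s ≤ k` and has
slope one for `s ≥ k + ε`. -/
noncomputable def ramp (k ε s : ℝ) : ℝ :=
  ∫ t in k..s, Real.smoothTransition ((t - k) / ε)

/-- The derivative of `ramp k ε`. -/
noncomputable def rampDeriv (k ε s : ℝ) : ℝ := Real.smoothTransition ((s - k) / ε)

lemma contDiff_rampDeriv (k ε : ℝ) : ContDiff ℝ ∞ (rampDeriv k ε) :=
  Real.smoothTransition.contDiff.comp ((contDiff_id.sub contDiff_const).div_const ε)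

lemma rampDeriv_nonneg (k ε s : ℝ) : 0 ≤ rampDeriv k ε s := Real.smoothTransition.nonneg _

lemma rampDeriv_le_one (k ε s : ℝ) : rampDeriv k ε s ≤ 1 := Real.smoothTransition.le_one _

lemma hasDerivAt_ramp (k ε s : ℝ) : HasDerivAt (ramp k ε) (rampDeriv k ε s) s :=
  (contDiff_rampDeriv k ε).continuous.integral_hasStrictDerivAt k s |>.hasDerivAt

lemma contDiff_ramp (k ε : ℝ) : ContDiff ℝ ∞ (ramp k ε) := by
  rw [contDiff_infty_iff_deriv]
  refine ⟨fun s => (hasDerivAt_ramp k ε s).differentiableAt, ?_⟩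
  rw [show deriv (ramp k ε) = rampDeriv k ε from funext fun s => (hasDerivAt_ramp k ε s).deriv]
  exact contDiff_rampDeriv k ε

lemma ramp_mono (k ε : ℝ) : Monotone (ramp k ε) :=
  monotone_of_hasDerivAt_nonneg (hasDerivAt_ramp k ε) (rampDeriv_nonneg k ε)

lemma lipschitzWith_ramp (k ε : ℝ) : LipschitzWith 1 (ramp k ε) := by
  refine lipschitzWith_of_nnnorm_deriv_le
    (fun s => (hasDerivAt_ramp k ε s).differentiableAt) fun s => ?_
  rw [(hasDerivAt_ramp k ε s).deriv, ← NNReal.coe_le_coe, coe_nnnorm,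
    Real.norm_of_nonneg (rampDeriv_nonneg k ε s)]
  exact rampDeriv_le_one k ε s

lemma ramp_of_le {k ε s : ℝ} (hε : 0 < ε) (hs : s ≤ k) : ramp k ε s = 0 := by
  refine intervalIntegral.integral_zero_ae (Eventually.of_forall fun t ht => ?_)
  rw [Set.uIoc_of_ge hs] at ht
  exact Real.smoothTransition.zero_of_nonpos
    (div_nonpos_of_nonpos_of_nonneg (by linarith [ht.2]) hε.le)

lemma ramp_nonneg {k ε : ℝ} (hε : 0 < ε) (s : ℝ) : 0 ≤ ramp k ε s := by
  rcases le_total s k with h | h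
  · exact (ramp_of_le hε h).ge
  · exact (ramp_of_le hε le_rfl).ge.trans (ramp_mono k ε h)

/-- On the boundary the regularized truncation is dominated by the distance to any value below the
level of truncation. -/
lemma abs_ramp_le {k ε c : ℝ} (hε : 0 < ε) (hc : c ≤ k) (s : ℝ) : |ramp k ε s| ≤ |s - c| := by
  rcases le_total s k with h | h
  · rw [ramp_of_le hε h, abs_zero]
    exact abs_nonneg _
  · have := (lipschitzWith_ramp k ε).dist_le_mul s k
    rw [ramp_of_le hε le_rfl, Real.dist_eq, Real.dist_eq, sub_zero, NNReal.coe_one, one_mul,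
      abs_of_nonneg (sub_nonneg.2 h)] at this
    rw [abs_of_nonneg (by linarith : 0 ≤ s - c)]
    linarith

lemma sub_le_ramp {k ε : ℝ} (hε : 0 < ε) (s : ℝ) : s - k - ε ≤ ramp k ε s := by
  rcases le_total s (k + ε) with h | h
  · linarith [ramp_nonneg hε (k := k) s]
  · have hd : ∀ t ∈ Set.Icc (k + ε) s, HasDerivWithinAt (ramp k ε) 1 (Set.Ici t) t := by
      intro t ht
      have h1 : rampDeriv k ε t = 1 :=
        Real.smoothTransition.one_of_one_le ((one_le_div hε).2 (by linarith [ht.1]))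
      exact h1 ▸ (hasDerivAt_ramp k ε t).hasDerivWithinAt
    have hint : ramp k ε s = ramp k ε (k + ε) + (s - (k + ε)) := by
      have h1 : ∀ t ∈ Set.Icc (k + ε) s, (t - (k + ε)) + ramp k ε (k + ε) = ramp k ε t := by
        intro t ht
        refine (eq_of_has_deriv_right_eq (f := ramp k ε) (f' := fun _ => 1)
          (g := fun t => (t - (k + ε)) + ramp k ε (k + ε)) (fun t ht => hd t ⟨ht.1, ht.2.le⟩)
          (fun t _ => (((hasDerivAt_id t).sub_const _).add_const _).hasDerivWithinAt)
          (contDiff_ramp k ε).continuous.continuousOn (by fun_prop) (by simp) t ht).symm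
      rw [← h1 s ⟨h, le_rfl⟩]
      ring
    linarith [ramp_nonneg hε (k := k) (k + ε)]

lemma gradient_comp {d : ℕ} {T : ℝ → ℝ} {T' : ℝ} {φ : E d → ℝ} {x : E d}
    (hT : HasDerivAt T T' (φ x)) (hφ : DifferentiableAt ℝ φ x) :
    gradient (fun y => T (φ y)) x = T' • gradient φ x := by
  have h : HasFDerivAt (fun y => T (φ y)) (T' • fderiv ℝ φ x) x :=
    hT.comp_hasFDerivAt x hφ.hasFDerivAt
  refine ext_inner_right ℝ fun y => ?_
  rw [inner_gradient_left, real_inner_smul_left, inner_gradient_left, h.fderiv]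
  simp

/-- Multiplication of a fixed `L²` vector field by bounded continuous functions is continuous for
convergence almost everywhere. -/
lemma tendsto_eLpNorm_smul_zero {α F : Type*} [MeasurableSpace α] [NormedAddCommGroup F]
    [NormedSpace ℝ F] {μ : Measure α} {G : α → F} (hG : MemLp G 2 μ) {c : ℕ → α → ℝ}
    (hc : ∀ k, AEStronglyMeasurable (c k) μ) (hb : ∀ k x, |c k x| ≤ 1)
    (hlim : ∀ᵐ x ∂μ, Tendsto (fun k => c k x) atTop (𝓝 0)) :
    Tendsto (fun k => eLpNorm (fun x => c k x • G x) 2 μ) atTop (𝓝 0) := by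
  have hpow : Tendsto (fun k => ∫⁻ x, ‖c k x • G x‖ₑ ^ 2 ∂μ) atTop (𝓝 (∫⁻ _, 0 ∂μ)) := by
    refine tendsto_lintegral_of_dominated_convergence' (fun x => ‖G x‖ₑ ^ 2)
      (fun k => ((hc k).smul hG.aestronglyMeasurable).enorm.pow_const 2)
      (fun k => Eventually.of_forall fun x => ?_) ?_ ?_
    · refine pow_le_pow_left' ?_ 2
      rw [enorm_smul]
      refine mul_le_of_le_one_left zero_le ?_
      rw [← ofReal_norm, Real.norm_eq_abs]
      exact ENNReal.ofReal_le_one.2 (hb k x)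
    · have := eLpNorm_nnreal_pow_eq_lintegral (f := G) (p := 2) (μ := μ) two_ne_zero
      have h2 : eLpNorm G 2 μ ^ 2 = ∫⁻ x, ‖G x‖ₑ ^ 2 ∂μ := by simpa using this
      rw [← h2]
      exact ENNReal.pow_ne_top hG.eLpNorm_ne_top
    · filter_upwards [hlim] with x hx
      have h1 : Tendsto (fun k => c k x • G x) atTop (𝓝 0) := by
        simpa using hx.smul_const (G x)
      have h2 := ((ENNReal.continuous_pow 2).tendsto _).comp h1.enorm
      rw [enorm_zero, zero_pow two_ne_zero] at h2
      exact h2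
  have h2 : ∀ k, eLpNorm (fun x => c k x • G x) 2 μ
      = (∫⁻ x, ‖c k x • G x‖ₑ ^ 2 ∂μ) ^ (1 / 2 : ℝ) := fun k => by
    rw [eLpNorm_eq_lintegral_rpow_enorm_toReal two_ne_zero (by simp)]
    simp
  simp only [h2]
  rw [lintegral_zero] at hpow
  simpa using hpow.ennrpow_const (1 / 2)

/-- **Truncation.** If `u ∈ H¹_g(Ω)` and `T` is a smooth function with `0 ≤ T' ≤ 1` which on the
boundary is dominated by the distance to `g`, then `T ∘ u ∈ H¹₀(Ω)`, and the chain rule holds. -/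
lemma MemH1g.comp_of_abs_le {n : ℕ} {Ω : Set (E (n + 1))} (hΩ : IsOpen Ω)
    (hb : Bornology.IsBounded Ω) (hσ : surf Ω Set.univ < ⊤) {g u : E (n + 1) → ℝ}
    {G : E (n + 1) → E (n + 1)} (hu : MemH1g Ω g u G) {T T' : ℝ → ℝ} (hT : ContDiff ℝ ∞ T)
    (hT' : Continuous T') (hd : ∀ s, HasDerivAt T (T' s) s) (h0 : ∀ s, 0 ≤ T' s)
    (h1 : ∀ s, T' s ≤ 1) (hL : LipschitzWith 1 T) (hT0 : T 0 = 0)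
    (hg : ∀ᵐ x ∂(surf Ω), ∀ s, |T s| ≤ |s - g x|) :
    MemH1g Ω 0 (fun x => T (u x)) (fun x => T' (u x) • G x) := by
  obtain ⟨φ, hφ, hφu, hφG, hφg⟩ := hu.trace
  have hmu := hu.hasH1Gradient.memLp
  have hmG := hu.hasH1Gradient.memLp_grad
  have hae : ∃ ns : ℕ → ℕ, StrictMono ns ∧
      ∀ᵐ x ∂(vol Ω), Tendsto (fun k => φ (ns k) x) atTop (𝓝 (u x)) :=
    (tendstoInMeasure_of_tendsto_eLpNorm two_ne_zero
      (fun k => (hφ k).continuous.aestronglyMeasurable) hmu.aestronglyMeasurable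
      hφu).exists_seq_tendsto_ae
  obtain ⟨ns, hns, hae⟩ := hae
  have hns := hns.tendsto_atTop
  have hφd : ∀ k, Differentiable ℝ (φ k) := fun k => (hφ k).differentiable (by simp)
  have hmT : MemLp (fun x => T (u x)) 2 (vol Ω) := by
    refine hmu.of_le (hL.continuous.comp_aestronglyMeasurable hmu.aestronglyMeasurable)
      (Eventually.of_forall fun x => ?_)
    simpa [hT0] using hL.dist_le_mul (u x) 0
  have hT'u : AEStronglyMeasurable (fun x => T' (u x)) (vol Ω) :=
    hT'.comp_aestronglyMeasurable hmu.aestronglyMeasurable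
  have hmTG : MemLp (fun x => T' (u x) • G x) 2 (vol Ω) := by
    refine hmG.of_le (hT'u.smul hmG.aestronglyMeasurable) (Eventually.of_forall fun x => ?_)
    rw [norm_smul, Real.norm_of_nonneg (h0 _)]
    exact mul_le_of_le_one_left (norm_nonneg _) (h1 _)
  let χ : ℕ → E (n + 1) → ℝ := fun k x => T (φ (ns k) x)
  have hχ : ∀ k, ContDiff ℝ ∞ (χ k) := fun k => hT.comp (hφ (ns k))
  have hχu : Tendsto (fun k => eLpNorm (fun x => χ k x - T (u x)) 2 (vol Ω)) atTop (𝓝 0) := by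
    refine tendsto_of_tendsto_of_tendsto_of_le_of_le tendsto_const_nhds (hφu.comp hns)
      (fun _ => zero_le) fun k => eLpNorm_mono fun x => ?_
    simpa [dist_eq_norm] using hL.dist_le_mul (φ (ns k) x) (u x)
  have hχG : Tendsto (fun k => eLpNorm (fun x => gradient (χ k) x - T' (u x) • G x) 2 (vol Ω))
      atTop (𝓝 0) := by
    have hT'φ : ∀ k, Continuous fun x => T' (φ (ns k) x) := fun k =>
      hT'.comp (hφ (ns k)).continuous
    -- `T'(φ) ∇φ - T'(u) G = T'(φ) (∇φ - G) + (T'(φ) - T'(u)) G`, and the second term converges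
    -- by dominated convergence along a subsequence converging almost everywhere.
    have hlim2 : Tendsto (fun k => eLpNorm (fun x => (T' (φ (ns k) x) - T' (u x)) • G x) 2 (vol Ω))
        atTop (𝓝 0) := by
      refine tendsto_eLpNorm_smul_zero hmG
        (fun k => (hT'φ k).aestronglyMeasurable.sub hT'u) (fun k x => ?_) ?_
      · rw [abs_le]
        constructor <;> linarith [h0 (φ (ns k) x), h1 (φ (ns k) x), h0 (u x), h1 (u x)]
      · filter_upwards [hae] with x hx
        simpa using ((hT'.tendsto (u x)).comp hx).sub_const (T' (u x))
    have hsum := (hφG.comp hns).add hlim2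
    rw [add_zero] at hsum
    refine tendsto_of_tendsto_of_tendsto_of_le_of_le tendsto_const_nhds hsum
      (fun _ => zero_le) fun k => ?_
    have hcg := continuous_gradient ((hφ (ns k)).of_le (m := 1) (by simp))
    have hm1 : AEStronglyMeasurable (fun x => T' (φ (ns k) x) • (gradient (φ (ns k)) x - G x))
        (vol Ω) :=
      (hT'φ k).aestronglyMeasurable.smul (hcg.aestronglyMeasurable.sub hmG.aestronglyMeasurable)
    have hm2 : AEStronglyMeasurable (fun x => (T' (φ (ns k) x) - T' (u x)) • G x) (vol Ω) :=
      ((hT'φ k).aestronglyMeasurable.sub hT'u).smul hmG.aestronglyMeasurable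
    calc eLpNorm (fun x => gradient (χ k) x - T' (u x) • G x) 2 (vol Ω)
        = eLpNorm ((fun x => T' (φ (ns k) x) • (gradient (φ (ns k)) x - G x))
            + fun x => (T' (φ (ns k) x) - T' (u x)) • G x) 2 (vol Ω) := by
          congr 1
          ext1 x
          simp only [χ, gradient_comp (hd (φ (ns k) x)) (hφd (ns k) x), Pi.add_apply]
          module
      _ ≤ eLpNorm (fun x => T' (φ (ns k) x) • (gradient (φ (ns k)) x - G x)) 2 (vol Ω)
            + eLpNorm (fun x => (T' (φ (ns k) x) - T' (u x)) • G x) 2 (vol Ω) :=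
          eLpNorm_add_le hm1 hm2 one_le_two
      _ ≤ _ := by
          refine add_le_add (eLpNorm_mono fun x => ?_) le_rfl
          rw [norm_smul, Real.norm_of_nonneg (h0 _)]
          exact mul_le_of_le_one_left (norm_nonneg _) (h1 _)
  have hχg : Tendsto (fun k => eLpNorm (χ k) 2 (surf Ω)) atTop (𝓝 0) := by
    refine tendsto_of_tendsto_of_tendsto_of_le_of_le tendsto_const_nhds (hφg.comp hns)
      (fun _ => zero_le) fun k => eLpNorm_mono_ae ?_
    filter_upwards [hg] with x hx
    exact hx _
  refine ⟨⟨hmT, hmTG, fun ψ hψ hψc _ i => ?_⟩, χ, hχ, hχu, hχG, by simpa using hχg⟩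
  exact integral_mul_partialDeriv_of_trace_zero hΩ hb hσ hmT hmTG
    (fun k => (hχ k).of_le (by simp)) hχu hχG hχg (hψ.of_le (by simp)) hψc i

/-! ### Stampacchia's lemma and integral inequalities -/

/-- **Stampacchia's lemma**: a nonincreasing function with superlinear decay from one level to
higher ones vanishes beyond an explicit level. Along the levels `k₀ + d (1 - 2⁻ˢ)` the function
decreases at least like `2 ^ (-2 p s / (p - 4))`. -/
lemma eq_zero_of_stampacchia {φ : ℝ → ℝ} (hanti : Antitone φ) (h0 : ∀ t, 0 ≤ φ t)
    {k₀ a κ p : ℝ} (hp : 4 < p) (ha : φ k₀ ≤ a) (hκ : 0 ≤ κ)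
    (hdec : ∀ k h, k₀ ≤ k → k < h → (h - k) * φ h ^ (1 / p) ≤ κ * φ k ^ ((p - 2) / (2 * p)))
    {h : ℝ} (hh : k₀ + κ * a ^ ((p - 4) / (2 * p)) * 2 ^ ((p - 2) / (p - 4)) < h) : φ h = 0 := by
  have ha0 : 0 ≤ a := (h0 k₀).trans ha
  have hp0 : 0 < p := by linarith
  have hp4 : 0 < p - 4 := by linarith
  set B : ℝ := a ^ ((p - 4) / (2 * p)) with hB
  have hB0 : 0 ≤ B := Real.rpow_nonneg ha0 _
  have hd0 : 0 ≤ κ * B * 2 ^ ((p - 2) / (p - 4)) := by positivity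
  have hkh : k₀ < h := by linarith
  -- If `κ = 0` or `a = 0` then the increment `d` below vanishes, and the iteration is empty.
  rcases hκ.eq_or_lt with rfl | hκ
  · have h1 := hdec k₀ h le_rfl hkh
    rw [zero_mul] at h1
    have h2 : φ h ^ (1 / p) = 0 :=
      le_antisymm (nonpos_of_mul_nonpos_right h1 (sub_pos.2 hkh)) (Real.rpow_nonneg (h0 h) _)
    exact ((Real.rpow_eq_zero_iff_of_nonneg (h0 h)).1 h2).1
  rcases ha0.eq_or_lt with rfl | hapos
  · exact le_antisymm ((hanti hkh.le).trans ha) (h0 h)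
  have hBpos : 0 < B := Real.rpow_pos_of_pos hapos _
  set θ : ℝ := 2 / (p - 4) with hθ
  have hθp : (p - 2) / (p - 4) = 1 + θ := by rw [hθ]; field_simp; ring
  set d : ℝ := κ * B * 2 ^ ((p - 2) / (p - 4)) with hd
  have hdpos : 0 < d := by positivity
  have hstep : ∀ s : ℕ, φ (k₀ + d * (1 - 2 ^ (-(s : ℝ)))) ≤ a * 2 ^ (-(s : ℝ) * (p * θ)) := by
    intro s
    induction s with
    | zero => simpa using ha
    | succ s ih =>
      have hs1 : (2 : ℝ) ^ (-(s : ℝ)) ≤ 1 :=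
        Real.rpow_le_one_of_one_le_of_nonpos one_le_two (by simp)
      have hs2 : (2 : ℝ) ^ (-((s + 1 : ℕ) : ℝ)) = 2 ^ (-(s : ℝ)) / 2 := by
        rw [Nat.cast_succ, neg_add, Real.rpow_add two_pos, Real.rpow_neg_one]
        rfl
      have hspos : (0 : ℝ) < 2 ^ (-(s : ℝ)) := by positivity
      have h1 := hdec (k₀ + d * (1 - 2 ^ (-(s : ℝ)))) (k₀ + d * (1 - 2 ^ (-((s + 1 : ℕ) : ℝ))))
        (by nlinarith) (by rw [hs2]; nlinarith)
      set x : ℝ := φ (k₀ + d * (1 - 2 ^ (-((s + 1 : ℕ) : ℝ)))) with hx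
      have hx0 : 0 ≤ x := h0 _
      have h2 : φ (k₀ + d * (1 - 2 ^ (-(s : ℝ)))) ^ ((p - 2) / (2 * p))
          ≤ B * a ^ (1 / p) * 2 ^ (-(s : ℝ) * (1 + θ)) := by
        refine (Real.rpow_le_rpow (h0 _) ih (div_nonneg (by linarith) (by linarith))).trans_eq ?_
        rw [Real.mul_rpow hapos.le (by positivity), ← Real.rpow_mul two_pos.le, hB,
          ← Real.rpow_add hapos]
        congr 2
        · field_simp
          ring
        · rw [← hθp, hθ]
          field_simp
      have h3 : d * (2 ^ (-(s : ℝ)) / 2) * x ^ (1 / p)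
          ≤ κ * (B * a ^ (1 / p) * 2 ^ (-(s : ℝ) * (1 + θ))) := by
        refine le_trans (le_of_eq ?_) (h1.trans (mul_le_mul_of_nonneg_left h2 hκ.le))
        rw [hs2]
        ring
      have h4 : d * (2 ^ (-(s : ℝ)) / 2) = κ * B * 2 ^ (θ - s) := by
        have h5 : (2 : ℝ) ^ (θ - s) = 2 ^ (1 + θ) * 2 ^ (-(s : ℝ)) / 2 := by
          rw [← Real.rpow_add two_pos, ← Real.rpow_sub_one two_ne_zero]
          congr 1
          ring
        rw [hd, hθp, h5]
        ring
      have h5 : x ^ (1 / p) ≤ a ^ (1 / p) * 2 ^ (-((s + 1 : ℕ) : ℝ) * θ) := by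
        have hpos : 0 < κ * B * 2 ^ (θ - s) := by positivity
        refine le_of_mul_le_mul_left ?_ hpos
        rw [h4] at h3
        refine h3.trans_eq ?_
        rw [show -(s : ℝ) * (1 + θ) = (θ - s) + -((s + 1 : ℕ) : ℝ) * θ by push_cast; ring,
          Real.rpow_add two_pos]
        ring
      have h6 := Real.rpow_le_rpow (Real.rpow_nonneg hx0 _) h5 hp0.le
      rw [Real.mul_rpow (by positivity) (by positivity), ← Real.rpow_mul hx0,
        ← Real.rpow_mul hapos.le, ← Real.rpow_mul two_pos.le, one_div,
        inv_mul_cancel₀ hp0.ne', Real.rpow_one, Real.rpow_one] at h6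
      rwa [mul_assoc, mul_comm θ p] at h6
  have hpθ : 0 < p * θ := by positivity
  have hlim : Tendsto (fun s : ℕ => a * (2 : ℝ) ^ (-(s : ℝ) * (p * θ))) atTop (𝓝 (a * 0)) := by
    refine Tendsto.const_mul a ?_
    have hq : (2 : ℝ) ^ (-(p * θ)) < 1 := Real.rpow_lt_one_of_one_lt_of_neg one_lt_two (by linarith)
    refine (tendsto_pow_atTop_nhds_zero_of_lt_one (by positivity) hq).congr fun s => ?_
    rw [← Real.rpow_natCast, ← Real.rpow_mul two_pos.le]
    congr 1
    ring
  rw [mul_zero] at hlim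
  refine le_antisymm (ge_of_tendsto' hlim fun s => le_trans (hanti ?_) (hstep s)) (h0 h)
  have : (0 : ℝ) < 2 ^ (-(s : ℝ)) := by positivity
  nlinarith

lemma abs_integral_mul_le {α : Type*} [MeasurableSpace α] {μ : Measure α} {f w : α → ℝ}
    (hf : MemLp f 2 μ) (hw : MemLp w 2 μ) :
    |∫ x, f x * w x ∂μ| ≤ (eLpNorm f 2 μ).toReal * (eLpNorm w 2 μ).toReal := by
  have h1 := eLpNorm_smul_le_mul_eLpNorm (p := 2) (q := 2) (r := 1) hw.aestronglyMeasurable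
    hf.aestronglyMeasurable
  rw [eLpNorm_one_eq_lintegral_enorm] at h1
  have h2 := (enorm_integral_le_lintegral_enorm fun x => f x * w x).trans h1
  have h3 := ENNReal.toReal_mono (ENNReal.mul_ne_top hf.eLpNorm_ne_top hw.eLpNorm_ne_top) h2
  rwa [ENNReal.toReal_mul, toReal_enorm] at h3

lemma integral_norm_sq_eq {α F : Type*} [MeasurableSpace α] [NormedAddCommGroup F] {μ : Measure α}
    {G : α → F} (hG : MemLp G 2 μ) : ∫ x, ‖G x‖ ^ 2 ∂μ = (eLpNorm G 2 μ).toReal ^ 2 := by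
  have h0 : 0 ≤ ∫ x, ‖G x‖ ^ 2 ∂μ := integral_nonneg fun x => sq_nonneg _
  rw [hG.eLpNorm_eq_integral_rpow_norm two_ne_zero (by simp), ENNReal.toReal_ofReal (by positivity)]
  simp only [ENNReal.toReal_ofNat, Real.rpow_ofNat]
  rw [← Real.rpow_natCast, ← Real.rpow_mul h0]
  norm_num

/-- Hölder's inequality on the support. -/
lemma toReal_eLpNorm_two_le_of_support_subset {α : Type*} [MeasurableSpace α] {μ : Measure α}
    [IsFiniteMeasure μ] {w : α → ℝ} {s : Set α} (hs : Function.support w ⊆ s) {p : ℝ} (hp : 2 < p)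
    (hw : MemLp w (ENNReal.ofReal p) μ) :
    (eLpNorm w 2 μ).toReal
      ≤ (eLpNorm w (ENNReal.ofReal p) μ).toReal * μ.real s ^ ((p - 2) / (2 * p)) := by
  have hres := fun q : ℝ≥0∞ => eLpNorm_restrict_eq_of_support_subset (p := q) (μ := μ) hs
  have h1 := eLpNorm_le_eLpNorm_mul_rpow_measure_univ (μ := μ.restrict s) (p := 2)
    (q := ENNReal.ofReal p) (by simpa using ENNReal.ofReal_le_ofReal hp.le)
    hw.aestronglyMeasurable.restrict
  have hexp : 1 / (2 : ℝ≥0∞).toReal - 1 / (ENNReal.ofReal p).toReal = (p - 2) / (2 * p) := by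
    rw [ENNReal.toReal_ofReal (by linarith), ENNReal.toReal_ofNat]
    have : p ≠ 0 := by linarith
    field_simp
  rw [hres, hres, Measure.restrict_apply_univ, hexp] at h1
  have hfin : μ s ^ ((p - 2) / (2 * p)) ≠ ⊤ :=
    (ENNReal.rpow_lt_top_of_nonneg (div_nonneg (by linarith) (by linarith))
      (measure_ne_top μ s)).ne
  have h2 := ENNReal.toReal_mono (ENNReal.mul_ne_top hw.eLpNorm_ne_top hfin) h1
  rwa [ENNReal.toReal_mul, ← ENNReal.toReal_rpow] at h2

/-- Chebyshev's inequality for the `L^p` norm. -/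
lemma mul_measureReal_rpow_le {α : Type*} [MeasurableSpace α] {μ : Measure α}
    [IsFiniteMeasure μ] {w : α → ℝ} {s : Set α} {c p : ℝ} (hp : 0 < p) (hc : 0 ≤ c)
    (hs : ∀ x ∈ s, c ≤ w x) (hw : MemLp w (ENNReal.ofReal p) μ) :
    c * μ.real s ^ (1 / p) ≤ (eLpNorm w (ENNReal.ofReal p) μ).toReal := by
  have hp' : ENNReal.ofReal p ≠ 0 := by simpa using hp
  have h1 := mul_meas_ge_le_pow_eLpNorm' μ hp' ENNReal.ofReal_ne_top hw.aestronglyMeasurable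
    (ENNReal.ofReal c)
  have hsub : s ⊆ {x | ENNReal.ofReal c ≤ ‖w x‖ₑ} := by
    intro x hx
    change ENNReal.ofReal c ≤ ‖w x‖ₑ
    rw [← ofReal_norm]
    exact ENNReal.ofReal_le_ofReal ((hs x hx).trans (le_abs_self _))
  rw [ENNReal.toReal_ofReal hp.le] at h1
  have h2 := (mul_le_mul_right (measure_mono hsub) (ENNReal.ofReal c ^ p)).trans h1
  have h3 := ENNReal.toReal_mono
    (ENNReal.rpow_lt_top_of_nonneg hp.le hw.eLpNorm_ne_top).ne h2
  rw [ENNReal.toReal_mul, ← ENNReal.toReal_rpow, ← ENNReal.toReal_rpow,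
    ENNReal.toReal_ofReal hc] at h3
  change c ^ p * μ.real s ≤ _ at h3
  have h4 := Real.rpow_le_rpow (by positivity) h3 (one_div_nonneg.2 hp.le)
  rwa [Real.mul_rpow (by positivity) (by positivity), one_div, Real.rpow_rpow_inv hc hp.ne',
    Real.rpow_rpow_inv ENNReal.toReal_nonneg hp.ne', ← one_div] at h4

/-! ### The maximum bound for weak solutions -/

/-- The energy density `D ∇u · T'(u) ∇u` of the truncated equation is integrable and dominates
`m |T'(u) ∇u|²`, because `0 ≤ T' ≤ 1`. -/
lemma IsDiffusionTensor.mul_integral_le {d : ℕ} {Ω : Set (E d)}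
    {D : E d → Matrix (Fin d) (Fin d) ℝ} {m M : ℝ} (hD : IsDiffusionTensor Ω D m M)
    {G : E d → E d} (hG : MemLp G 2 (vol Ω)) {c : E d → ℝ} (h0 : ∀ x, 0 ≤ c x)
    (h1 : ∀ x, c x ≤ 1) (hcG : MemLp (fun x => c x • G x) 2 (vol Ω)) :
    m * (eLpNorm (fun x => c x • G x) 2 (vol Ω)).toReal ^ 2
      ≤ ∫ x in Ω, ∑ i, ∑ j, D x i j * G x j * (c x • G x) i := by
  rw [← integral_norm_sq_eq hcG, ← integral_const_mul]
  have hint : Integrable (fun x => ∑ i, ∑ j, D x i j * G x j * (c x • G x) i) (vol Ω) := by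
    refine integrable_finsetSum _ fun i _ => integrable_finsetSum _ fun j _ => ?_
    have h2 : MemLp (fun x => D x i j * G x j) 2 (vol Ω) := (MemLp.coord hG j).mul (hD.memLp i j)
    exact h2.integrable_mul (MemLp.coord hcG i)
  refine integral_mono_ae (hcG.norm.integrable_sq.const_mul m) hint ?_
  filter_upwards [hD.elliptic] with x hx
  have h2 := (hx (G x)).1
  have h3 : ∑ i, ∑ j, D x i j * G x j * (c x • G x) i
      = c x * ∑ i, ∑ j, G x i * D x i j * G x j := by
    simp only [Finset.mul_sum, PiLp.smul_apply, smul_eq_mul]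
    exact Finset.sum_congr rfl fun i _ => Finset.sum_congr rfl fun j _ => by ring
  rw [h3, norm_smul, Real.norm_of_nonneg (h0 x)]
  have h4 : m * (c x * ‖G x‖) ^ 2 ≤ c x * (m * ‖G x‖ ^ 2) := by
    have h5 : 0 ≤ m * ‖G x‖ ^ 2 := mul_nonneg hD.m_pos.le (sq_nonneg _)
    nlinarith [mul_nonneg (mul_nonneg (h0 x) (sub_nonneg.2 (h1 x))) h5]
  exact h4.trans (mul_le_mul_of_nonneg_left h2 (h0 x))

/-- The decay estimate between two levels `k < h`, obtained by testing the equation with the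
regularized truncation of `u` at level `k`. -/
lemma IsWeakSolution.level_decay {n : ℕ} {Ω : Set (E (n + 1))} (hΩ : IsOpen Ω)
    (hb : Bornology.IsBounded Ω) (hσ : surf Ω Set.univ < ⊤) {p K : ℝ} (hp : 4 < p)
    (hK : IsPoincareSobolevConst Ω p K) {D : E (n + 1) → Matrix (Fin (n + 1)) (Fin (n + 1)) ℝ}
    {m M : ℝ} (hD : IsDiffusionTensor Ω D m M) {b : E (n + 1) → ℝ → ℝ}
    (hb0 : ∀ x ∈ Ω, ∀ ξ, 0 ≤ ξ → 0 ≤ b x ξ) {f g u : E (n + 1) → ℝ} (hf : MemLp f 2 (vol Ω))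
    (hu : IsWeakSolution Ω D b f g u) {k h : ℝ} (hk : 0 ≤ k) (hkh : k < h)
    (hg : ∀ᵐ x ∂(surf Ω), g x ≤ k) :
    (h - k) * (vol Ω).real {x | h < u x} ^ (1 / p)
      ≤ K ^ 2 / m * (eLpNorm f 2 (vol Ω)).toReal
        * (vol Ω).real {x | k < u x} ^ ((p - 2) / (2 * p)) := by
  have : IsFiniteMeasure (vol Ω) := ⟨by simpa using hb.measure_lt_top⟩
  have hm := hD.m_pos
  set F := (eLpNorm f 2 (vol Ω)).toReal
  set α := (vol Ω).real {x | k < u x} ^ ((p - 2) / (2 * p))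
  have hα0 : 0 ≤ α := by positivity
  have hF0 : 0 ≤ F := ENNReal.toReal_nonneg
  obtain ⟨G, hG, hsol⟩ := hu
  have key : ∀ ε : ℝ, 0 < ε → ε < h - k →
      (h - k - ε) * (vol Ω).real {x | h < u x} ^ (1 / p) ≤ K ^ 2 / m * F * α := by
    intro ε hε hεh
    have hv := hG.comp_of_abs_le hΩ hb hσ (contDiff_ramp k ε) (contDiff_rampDeriv k ε).continuous
      (hasDerivAt_ramp k ε) (rampDeriv_nonneg k ε) (rampDeriv_le_one k ε) (lipschitzWith_ramp k ε)
      (ramp_of_le hε hk) (hg.mono fun x hx => abs_ramp_le hε hx)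
    have hmv := hv.hasH1Gradient.memLp
    have hmGv := hv.hasH1Gradient.memLp_grad
    have hsob := hK.2 _ _ hv
    have hfin : ENNReal.ofReal K * eLpNorm (fun x => rampDeriv k ε (u x) • G x) 2 (vol Ω) ≠ ⊤ :=
      ENNReal.mul_ne_top ENNReal.ofReal_ne_top hmGv.eLpNorm_ne_top
    have hmvp : MemLp (fun x => ramp k ε (u x)) (ENNReal.ofReal p) (vol Ω) :=
      ⟨hmv.aestronglyMeasurable, hsob.trans_lt hfin.lt_top⟩
    have hN : (eLpNorm (fun x => ramp k ε (u x)) (ENNReal.ofReal p) (vol Ω)).toReal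
        ≤ K * (eLpNorm (fun x => rampDeriv k ε (u x) • G x) 2 (vol Ω)).toReal := by
      have := ENNReal.toReal_mono hfin hsob
      rwa [ENNReal.toReal_mul, ENNReal.toReal_ofReal hK.1] at this
    have hell := hD.mul_integral_le hG.hasH1Gradient.memLp_grad
      (fun x => rampDeriv_nonneg k ε (u x)) (fun x => rampDeriv_le_one k ε (u x)) hmGv
    -- Where the test function does not vanish, `u > k ≥ 0`, so that `b(x, u) ≥ 0`.
    have hbv : 0 ≤ ∫ x in Ω, b x (u x) * ramp k ε (u x) := by
      refine setIntegral_nonneg hΩ.measurableSet fun x hx => ?_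
      rcases le_total (u x) k with hxk | hxk
      · rw [ramp_of_le hε hxk, mul_zero]
      · exact mul_nonneg (hb0 x hx _ (hk.trans hxk)) (ramp_nonneg hε _)
    have heq := (hsol _ _ hv).2
    have hfv := (le_abs_self _).trans (abs_integral_mul_le hf hmv)
    have hsupp : (Function.support fun x => ramp k ε (u x)) ⊆ {x | k < u x} := by
      intro x hx
      by_contra hcon
      exact hx (ramp_of_le hε (not_lt.1 hcon))
    have hhol := toReal_eLpNorm_two_le_of_support_subset hsupp (by linarith) hmvp
    have hche := mul_measureReal_rpow_le (μ := vol Ω) (s := {x | h < u x}) (c := h - k - ε)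
      (by linarith : 0 < p) (by linarith)
      (fun x (hx : h < u x) => le_trans (by linarith) (sub_le_ramp hε (u x))) hmvp
    set N := (eLpNorm (fun x => ramp k ε (u x)) (ENNReal.ofReal p) (vol Ω)).toReal
    set γ := (eLpNorm (fun x => rampDeriv k ε (u x) • G x) 2 (vol Ω)).toReal with hγ
    have hγ0 : 0 ≤ γ := ENNReal.toReal_nonneg
    refine hche.trans ?_
    have henergy : m * γ ^ 2 ≤ F * (K * γ * α) := by
      have h2 : F * (eLpNorm (fun x => ramp k ε (u x)) 2 (vol Ω)).toReal ≤ F * (K * γ * α) := by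
        gcongr
        exact hhol.trans (mul_le_mul_of_nonneg_right hN hα0)
      linarith
    -- Divide by `γ`, which may vanish.
    have hγle : m * γ ≤ F * K * α := by
      rcases hγ0.eq_or_lt with h2 | h2
      · rw [← h2, mul_zero]
        exact mul_nonneg (mul_nonneg hF0 hK.1) hα0
      · refine le_of_mul_le_mul_right ?_ h2
        linarith
    calc N ≤ K * γ := hN
      _ ≤ K * (F * K * α / m) := by
          refine mul_le_mul_of_nonneg_left ?_ hK.1
          rw [le_div_iff₀ hm]
          linarith
      _ = K ^ 2 / m * F * α := by ring
  have hlim : Tendsto (fun ε : ℝ => (h - k - ε) * (vol Ω).real {x | h < u x} ^ (1 / p)) (𝓝[>] 0)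
      (𝓝 ((h - k - 0) * (vol Ω).real {x | h < u x} ^ (1 / p))) :=
    tendsto_nhdsWithin_of_tendsto_nhds (Continuous.tendsto (by fun_prop) 0)
  rw [sub_zero] at hlim
  refine le_of_tendsto hlim ?_
  filter_upwards [Ioo_mem_nhdsGT (sub_pos.2 hkh)] with ε hε
  exact key ε hε.1 hε.2

/-- The upper bound, under the only properties of the nonlinearity and of the boundary data that
it depends on. -/
lemma IsWeakSolution.ae_le {n : ℕ} {Ω : Set (E (n + 1))} (hΩ : IsOpen Ω)
    (hb : Bornology.IsBounded Ω) (hσ : surf Ω Set.univ < ⊤) {p K : ℝ} (hp : 4 < p)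
    (hK : IsPoincareSobolevConst Ω p K) {D : E (n + 1) → Matrix (Fin (n + 1)) (Fin (n + 1)) ℝ}
    {m M : ℝ} (hD : IsDiffusionTensor Ω D m M) {b : E (n + 1) → ℝ → ℝ}
    (hb0 : ∀ x ∈ Ω, ∀ ξ, 0 ≤ ξ → 0 ≤ b x ξ) {f g u : E (n + 1) → ℝ} (hf : MemLp f 2 (vol Ω))
    (hu : IsWeakSolution Ω D b f g u) {k₀ : ℝ} (hk₀ : 0 ≤ k₀) (hg : ∀ᵐ x ∂(surf Ω), g x ≤ k₀) :
    ∀ᵐ x ∂(vol Ω), u x ≤ k₀ + boundConst Ω m p K * (eLpNorm f 2 (vol Ω)).toReal := by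
  have : IsFiniteMeasure (vol Ω) := ⟨by simpa using hb.measure_lt_top⟩
  set F := (eLpNorm f 2 (vol Ω)).toReal
  have hF0 : 0 ≤ F := ENNReal.toReal_nonneg
  have hzero : ∀ h, k₀ + boundConst Ω m p K * F < h → (vol Ω).real {x | h < u x} = 0 := by
    intro h hh
    refine eq_zero_of_stampacchia (φ := fun t => (vol Ω).real {x | t < u x})
      (a := (volume Ω).toReal) (κ := K ^ 2 / m * F) (k₀ := k₀) (p := p) ?_
      (fun t => measureReal_nonneg) hp ?_ ?_ ?_ ?_
    · intro s t hst
      exact measureReal_mono (fun x (hx : t < u x) => lt_of_le_of_lt hst hx)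
    · refine (measureReal_mono (Set.subset_univ _)).trans_eq ?_
      rw [Measure.real, Measure.restrict_apply_univ]
    · exact mul_nonneg (div_nonneg (sq_nonneg _) hD.m_pos.le) hF0
    · intro k h' hk hkh
      exact hu.level_decay hΩ hb hσ hp hK hD hb0 hf (hk₀.trans hk) hkh
        (hg.mono fun x hx => hx.trans hk)
    · refine lt_of_eq_of_lt ?_ hh
      unfold boundConst
      ring
  have hae : ∀ j : ℕ, ∀ᵐ x ∂(vol Ω),
      u x ≤ k₀ + boundConst Ω m p K * F + 1 / ((j : ℝ) + 1) := by
    intro j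
    have h1 := hzero (k₀ + boundConst Ω m p K * F + 1 / ((j : ℝ) + 1))
      (lt_add_of_pos_right _ (by positivity))
    rw [measureReal_eq_zero_iff] at h1
    rw [ae_iff]
    simpa only [not_le] using h1
  filter_upwards [ae_all_iff.2 hae] with x hx
  have hlim := (tendsto_one_div_add_atTop_nhds_zero_nat (𝕜 := ℝ)).const_add
    (k₀ + boundConst Ω m p K * F)
  rw [add_zero] at hlim
  exact ge_of_tendsto' hlim hx

lemma gradient_neg {d : ℕ} (φ : E d → ℝ) (x : E d) :
    gradient (fun y => -φ y) x = -gradient φ x := by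
  refine ext_inner_right ℝ fun y => ?_
  rw [inner_gradient_left, inner_neg_left, inner_gradient_left, fderiv_fun_neg]
  rfl

lemma MemH1g.neg {d : ℕ} {Ω : Set (E d)} {g u : E d → ℝ} {G : E d → E d} (hu : MemH1g Ω g u G) :
    MemH1g Ω (fun x => -g x) (fun x => -u x) (fun x => -G x) := by
  have hneg : ∀ {F : Type} [NormedAddCommGroup F] (v w : E d → F) (μ : Measure (E d)),
      eLpNorm (fun x => -v x - -w x) 2 μ = eLpNorm (fun x => v x - w x) 2 μ := by
    intro F _ v w μ
    rw [← eLpNorm_neg (fun x => v x - w x)]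
    congr 1
    ext1 x
    simp only [Pi.neg_apply]
    abel
  obtain ⟨φ, hφ, hφu, hφG, hφg⟩ := hu.trace
  refine ⟨⟨hu.hasH1Gradient.memLp.neg, hu.hasH1Gradient.memLp_grad.neg, fun ψ hψ hψc hψΩ i => ?_⟩,
    fun k x => -φ k x, fun k => (hφ k).neg, ?_, ?_, ?_⟩
  · have := hu.hasH1Gradient.weak_deriv ψ hψ hψc hψΩ i
    simp only [neg_mul, integral_neg, PiLp.neg_apply, this]
  · simpa only [hneg] using hφu
  · simpa only [gradient_neg, hneg] using hφG
  · simpa only [hneg] using hφg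

lemma IsWeakSolution.neg {d : ℕ} {Ω : Set (E d)} {D : E d → Matrix (Fin d) (Fin d) ℝ}
    {b : E d → ℝ → ℝ} {f g u : E d → ℝ} (hu : IsWeakSolution Ω D b f g u) :
    IsWeakSolution Ω D (fun x ξ => -b x (-ξ)) (fun x => -f x) (fun x => -g x)
      (fun x => -u x) := by
  obtain ⟨G, hG, hsol⟩ := hu
  refine ⟨fun x => -G x, hG.neg, fun v Gv hv => ?_⟩
  obtain ⟨h1, h2⟩ := hsol v Gv hv
  simp only [neg_neg, neg_mul, PiLp.neg_apply, mul_neg, Finset.sum_neg_distrib, integral_neg]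
  exact ⟨h1.neg, by linarith⟩

lemma IsMonotoneCaratheodory.monotone_of_mem {d : ℕ} {Ω : Set (E d)} {b : E d → ℝ → ℝ}
    (hb : IsMonotoneCaratheodory Ω b) {x : E d} (hx : x ∈ Ω) : Monotone (b x) :=
  monotone_of_deriv_nonneg ((hb.smooth x hx).differentiable (by simp)) (hb.monotone x hx)

lemma ae_le_essSup_and_essInf_le_ae {α : Type*} [MeasurableSpace α] {μ : Measure α} {g : α → ℝ}
    (hg : MemLp g ∞ μ) : ∀ᵐ x ∂μ, essInf g μ ≤ g x ∧ g x ≤ essSup g μ := by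
  have hfin : eLpNormEssSup g μ ≠ ⊤ := by simpa using hg.eLpNorm_ne_top
  have hbd : ∀ᵐ x ∂μ, |g x| ≤ (eLpNormEssSup g μ).toReal := by
    filter_upwards [ae_le_eLpNormEssSup (f := g) (μ := μ)] with x hx
    have := ENNReal.toReal_mono hfin hx
    rwa [toReal_enorm] at this
  have h1 : IsBoundedUnder (· ≤ ·) (ae μ) g :=
    isBoundedUnder_of_eventually_le (hbd.mono fun x hx => (abs_le.1 hx).2)
  have h2 : IsBoundedUnder (· ≥ ·) (ae μ) g :=
    isBoundedUnder_of_eventually_ge (hbd.mono fun x hx => (abs_le.1 hx).1)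
  filter_upwards [ae_le_essSup h1, ae_essInf_le h2] with x hx1 hx2
  exact ⟨hx2, hx1⟩

end SemilinearPDE

theorem theorem2p2 (d : ℕ) (p : ℝ) (hdp : (d = 2 ∧ 4 < p) ∨ (d = 3 ∧ p = 6))
    (Ω : Set (SemilinearPDE.E d)) (hΩ : SemilinearPDE.IsBoundedLipschitzDomain Ω) :
    (∃ Cs : ℝ, SemilinearPDE.IsPoincareSobolevConst Ω p Cs) ∧
    ∀ (Cs : ℝ), SemilinearPDE.IsPoincareSobolevConst Ω p Cs →
    ∀ (D : SemilinearPDE.E d → Matrix (Fin d) (Fin d) ℝ) (m M : ℝ)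
      (b : SemilinearPDE.E d → ℝ → ℝ) (f g u : SemilinearPDE.E d → ℝ),
      SemilinearPDE.IsDiffusionTensor Ω D m M →
      MemLp f 2 (SemilinearPDE.vol Ω) →
      MemLp g ∞ (SemilinearPDE.surf Ω) →
      SemilinearPDE.IsMonotoneCaratheodory Ω b →
      SemilinearPDE.IsWeakSolution Ω D b f g u →
      ∀ᵐ x ∂(SemilinearPDE.vol Ω),
        min 0 (essInf g (SemilinearPDE.surf Ω))
            - SemilinearPDE.boundConst Ω m p Cs * (eLpNorm f 2 (SemilinearPDE.vol Ω)).toReal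
          ≤ u x ∧
        u x ≤ max 0 (essSup g (SemilinearPDE.surf Ω))
            + SemilinearPDE.boundConst Ω m p Cs * (eLpNorm f 2 (SemilinearPDE.vol Ω)).toReal := by
  -- For `d = n + 1`, the dimension `d - 1` of the surface measure is definitionally `n`.
  obtain ⟨n, rfl⟩ : ∃ n, d = n + 1 := by
    rcases hdp with ⟨rfl, -⟩ | ⟨rfl, -⟩
    exacts [⟨1, rfl⟩, ⟨2, rfl⟩]
  have hp : 4 < p := by
    rcases hdp with ⟨-, hp⟩ | ⟨-, rfl⟩
    exacts [hp, by norm_num]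
  refine ⟨SemilinearPDE.exists_isPoincareSobolevConst hdp hΩ, ?_⟩
  intro Cs hCs D m M b f g u hD hf hg hb hu
  have hσ := hΩ.surf_univ_lt_top
  have hgb := SemilinearPDE.ae_le_essSup_and_essInf_le_ae hg
  have hup := hu.ae_le hΩ.isOpen hΩ.isBounded hσ hp hCs hD
    (fun x hx ξ hξ => (hb.zero x hx).ge.trans (hb.monotone_of_mem hx hξ)) hf
    (le_max_left 0 (essSup g (SemilinearPDE.surf Ω)))
    (hgb.mono fun x hx => hx.2.trans (le_max_right _ _))
  have hlow := hu.neg.ae_le hΩ.isOpen hΩ.isBounded hσ hp hCs hD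
    (fun x hx ξ hξ => neg_nonneg.2
      ((hb.monotone_of_mem hx (neg_nonpos.2 hξ)).trans (hb.zero x hx).le)) hf.neg
    (neg_nonneg.2 (min_le_left 0 (essInf g (SemilinearPDE.surf Ω))))
    (hgb.mono fun x hx => neg_le_neg ((min_le_right _ _).trans hx.1))
  rw [eLpNorm_neg] at hlow
  filter_upwards [hup, hlow] with x h1 h2
  exact ⟨by linarith, h1⟩
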